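/- Let $p,q$ be integers with $q\ge 1$ and $p\ge 2q$. Let $H_{p,q}=M_{p,q}(\mathbb C)\times\mathbb R$ be the Heisenberg group with product $(x,a)(y,b)=(x+y,\;a+b-\operatorname{Im}\operatorname{tr}(x^*y))$, on which the unitary group $U_p$ acts by automorphisms $u(x,a)=(ux,a)$, and let $G_{p,q}=U_p\ltimes H_{p,q}$. Let $\Pi_q$ be the cone of positive semidefinite Hermitian $q\times q$ matrices. The double coset space $G_{p,q}//U_p$ (the space of $U_p$-orbits in $H_{p,q}$) is identified with $\Pi_q\times\mathbb R$ through the projection $P$ that sends an element of $G_{p,q}$ with $H_{p,q}$-component $(x,a)$ to $(\sqrt{x^*x},a)$. Taking image measures under $P$ identifies the $U_p$-biinvariant bounded Borel measures on $G_{p,q}$ with the bounded Borel measures on $\Pi_q\times\mathbb R$; let $*_{p,q}$ be the convolution of measures on $\Pi_q\times\mathbb R$ obtained by transferring the convolution of $U_p$-biinvariant measures on the group $G_{p,q}$ through this identification. Put $B_q=\{w\in M_{q,q}(\mathbb C): I_q-w^*w \text{ is positive definite}\}$, write $\Delta$ for the determinant of a $q\times q$ matrix and $dw$ for Lebesgue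 measure on $M_{q,q}(\mathbb C)$. Then $w\mapsto\Delta(I_q-w^*w)^{p-2q}$ is integrable on $B_q$, $$\kappa_{p,q}:=\Bigl(\int_{B_q}\Delta(I_q-w^*w)^{p-2q}\,dw\Bigr)^{-1}>0,$$ and for all $r,s\in\Pi_q$ and $a,b\in\mathbb R$ the convolution $\delta_{(r,a)}*_{p,q}\delta_{(s,b)}$ of point measures is the probability measure given, for every bounded continuous $f:\Pi_q\times\mathbb R\to\mathbb C$, by the (absolutely convergent) integral $$(\delta_{(r,a)}*_{p,q}\delta_{(s,b)})(f)=\kappa_{p,q}\int_{B_q} f\Bigl(\sqrt{r^2+s^2+rws+(rws)^*},\;a+b-\operatorname{Im}\operatorname{tr}(rws)\Bigr)\,\Delta(I_q-w^*w)^{p-2q}\,dw .$$ -/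

import Mathlib

open Matrix MeasureTheory
open scoped MatrixOrder ComplexOrder BoundedContinuousFunction

noncomputable section

namespace HeisenbergConvolution

/-- The Heisenberg group `H_{p,q} = M_{p,q}(ℂ) × ℝ`. -/
@[ext]
structure Heis (p q : ℕ) where
  x : Matrix (Fin p) (Fin q) ℂ
  a : ℝ

namespace Heis

variable {p q : ℕ}

/-- The product `(x, a) (y, b) = (x + y, a + b - Im tr (x^* y))`. -/
instance : Mul (Heis p q) :=
  ⟨fun g h => ⟨g.x + h.x, g.a + h.a - (trace (g.xᴴ * h.x)).im⟩⟩

instance : One (Heis p q) := ⟨⟨0, 0⟩⟩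

instance : Inv (Heis p q) := ⟨fun g => ⟨-g.x, -g.a⟩⟩

@[simp] theorem mul_x (g h : Heis p q) : (g * h).x = g.x + h.x := rfl

@[simp] theorem mul_a (g h : Heis p q) :
    (g * h).a = g.a + h.a - (trace (g.xᴴ * h.x)).im := rfl

@[simp] theorem one_x : (1 : Heis p q).x = 0 := rfl

@[simp] theorem one_a : (1 : Heis p q).a = 0 := rfl

@[simp] theorem inv_x (g : Heis p q) : (g⁻¹).x = -g.x := rfl

@[simp] theorem inv_a (g : Heis p q) : (g⁻¹).a = -g.a := rfl

theorem trace_self_im (x : Matrix (Fin p) (Fin q) ℂ) : (trace (xᴴ * x)).im = 0 := by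
  have h : star (trace (xᴴ * x)) = trace (xᴴ * x) := by
    rw [← trace_conjTranspose, conjTranspose_mul, conjTranspose_conjTranspose]
  exact Complex.conj_eq_iff_im.mp h

instance : Group (Heis p q) :=
  Group.ofLeftAxioms
    (fun g h k => by
      ext1
      · simp [add_assoc]
      · simp [Matrix.add_mul, Matrix.mul_add]
        ring)
    (fun g => by ext1 <;> simp)
    (fun g => by ext1 <;> simp [trace_self_im])

instance : TopologicalSpace (Heis p q) :=
  TopologicalSpace.induced (fun g => (g.x, g.a)) inferInstance

end Heis

/-- The unitary group `U_p`. -/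
abbrev U (p : ℕ) := Matrix.unitaryGroup (Fin p) ℂ

/-- The action `u (x, a) = (u x, a)` of `U_p` on `H_{p,q}` by automorphisms. -/
def action (p q : ℕ) : U p →* MulAut (Heis p q) where
  toFun u :=
    { toFun := fun g => ⟨(u : Matrix (Fin p) (Fin p) ℂ) * g.x, g.a⟩
      invFun := fun g => ⟨(star u : Matrix (Fin p) (Fin p) ℂ) * g.x, g.a⟩
      left_inv := fun g => by
        ext1
        · simp [← Matrix.mul_assoc]
        · rfl
      right_inv := fun g => by
        ext1
        · simp [← Matrix.mul_assoc]
        · rfl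
      map_mul' := fun g h => by
        ext1
        · simp [Matrix.mul_add]
        · have hu : (u : Matrix (Fin p) (Fin p) ℂ)ᴴ * (u : Matrix (Fin p) (Fin p) ℂ) = 1 :=
            Unitary.coe_star_mul_self u
          simp only [Heis.mul_a, conjTranspose_mul]
          rw [Matrix.mul_assoc, ← Matrix.mul_assoc _ _ h.x, hu, Matrix.one_mul] }
  map_one' := by
    ext g : 2
    · simp
    · rfl
  map_mul' u v := by
    ext g : 2
    · simp [Matrix.mul_assoc]
    · rfl

/-- The semidirect product `G_{p,q} = U_p ⋉ H_{p,q}`; its elements are pairs `⟨h, u⟩` with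
`⟨h, u⟩ ⟨h', u'⟩ = ⟨h (u h'), u u'⟩`. -/
abbrev G (p q : ℕ) := Heis p q ⋊[action p q] U p

instance (p q : ℕ) : TopologicalSpace (G p q) :=
  TopologicalSpace.induced (fun g => (g.left, g.right)) inferInstance

instance (p q : ℕ) : MeasurableSpace (G p q) := borel _

instance (p q : ℕ) : BorelSpace (G p q) := ⟨rfl⟩

/-- The cone `Π_q` of positive semidefinite Hermitian `q × q` matrices. -/
abbrev Cone (q : ℕ) := {z : Matrix (Fin q) (Fin q) ℂ // z.PosSemidef}

instance (q : ℕ) : MeasurableSpace (Cone q) := borel _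

instance (q : ℕ) : BorelSpace (Cone q) := ⟨rfl⟩

/-- The positive semidefinite square root of a positive semidefinite matrix. (The value at other
matrices is irrelevant.) -/
def psdSqrt {q : ℕ} (z : Matrix (Fin q) (Fin q) ℂ) : Cone q :=
  ⟨CFC.sqrt z, Matrix.nonneg_iff_posSemidef.mp (CFC.sqrt_nonneg z)⟩

/-- The projection `P : G_{p,q} → Π_q × ℝ`, `((x, a), u) ↦ (|x|, a)` with `|x| = √(x^* x)`, which
identifies the double coset space `G_{p,q} // U_p`, i.e. the space of `U_p`-orbits in `H_{p,q}`,
with `Π_q × ℝ`. -/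
def proj (p q : ℕ) (g : G p q) : Cone q × ℝ :=
  (psdSqrt (g.left.xᴴ * g.left.x), g.left.a)

/-- `μ` is a bounded Borel measure on `G_{p,q}` that is biinvariant under the subgroup `U_p`. -/
structure IsBiinvariant {p q : ℕ} (μ : Measure (G p q)) : Prop where
  finite : IsFiniteMeasure μ
  map_left : ∀ k : U p, μ.map (fun g => SemidirectProduct.inr k * g) = μ
  map_right : ∀ k : U p, μ.map (fun g => g * SemidirectProduct.inr k) = μ

open Classical in
/-- The inverse of `μ ↦ P(μ)`: the unique biinvariant bounded measure on `G_{p,q}` whose image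
under `P` is `m` (and `0` if there is no such unique measure). -/
def lift (p : ℕ) {q : ℕ} (m : Measure (Cone q × ℝ)) : Measure (G p q) :=
  if h : ∃! μ : Measure (G p q), IsBiinvariant μ ∧ μ.map (proj p q) = m then h.choose else 0

/-- The orbit convolution `*_{p,q}` on `Π_q × ℝ`: the convolution of biinvariant measures on the
group `G_{p,q}`, transferred to `Π_q × ℝ` by `P`. -/
def orbitConv (p : ℕ) {q : ℕ} (m n : Measure (Cone q × ℝ)) : Measure (Cone q × ℝ) :=
  (Measure.mconv (lift p m) (lift p n)).map (proj p q)

/-- `M_{q,q}(ℂ)` as the space of arrays of entries, which carries Lebesgue measure `volume`. -/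
abbrev Entries (q : ℕ) := Fin q → Fin q → ℂ

/-- The matrix ball `B_q = {w : w^* w < I_q}`. -/
def matrixBall (q : ℕ) : Set (Entries q) :=
  {w | (1 - (Matrix.of w)ᴴ * Matrix.of w).PosDef}

/-- `Δ(I_q - w^* w)`; the determinant of this Hermitian matrix is real. -/
def ballDet {q : ℕ} (w : Entries q) : ℝ :=
  (det (1 - (Matrix.of w)ᴴ * Matrix.of w)).re

/-- `κ_{p,q}`, for `p ≥ 2 q`. -/
def kappa (p q : ℕ) : ℝ :=
  (∫ w in matrixBall q, ballDet w ^ (p - 2 * q))⁻¹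

/-- The point `(√(r² + s² + r w s + (r w s)^*), a + b - Im tr (r w s))` of `Π_q × ℝ`. -/
def convPoint {q : ℕ} (r s : Cone q) (a b : ℝ) (w : Entries q) : Cone q × ℝ :=
  (psdSqrt (r.1 ^ 2 + s.1 ^ 2 + r.1 * Matrix.of w * s.1 + (r.1 * Matrix.of w * s.1)ᴴ),
    a + b - (trace (r.1 * Matrix.of w * s.1)).im)

end HeisenbergConvolution

end

/-! The group side reduces to one random unitary matrix. By polar decomposition, `xᴴ x = yᴴ y`
forces `y = u x` with `u` unitary, so the fibres of `proj` are double cosets. The biinvariant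
measure over a point mass is therefore unique: it is the law of `k h l` with independent Haar
unitaries `k`, `l` (`lift_dirac`). In a product of two such elements the outer unitaries are
invisible to `proj` and the two inner ones merge into a single Haar unitary `u`. Expanding the Gram
matrix shows that the result depends on `u` only through its upper left `q × q` block `w`
(`proj_mul_eq_convPoint`, `lintegral_orbitConv`).

It remains to see that `w` has density proportional to `Δ(I - wᴴ w)^(p - 2q)` (`lintegral_block`).
For `Z` in `M_{p,q}` under Lebesgue measure, `Z (Zᴴ Z)^(-1/2)` is distributed like the first `q`
columns of a Haar unitary and is independent of `Zᴴ Z` (`lintegral_normalizedBlock`). Split `Z` into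
a `q × q` block `A` and an `n × q` block `C` with `n = p - q ≥ q`. The Gram matrix `Cᴴ C` has law
proportional to `Δ(X)^(n - q) dX`; substituting `X = Y - Aᴴ A` and `A = w √Y` factors the integrand
into a function of `Y` and `Δ(I - wᴴ w)^(n - q)` (`exists_lintegral_block_eq`).

The law of `Cᴴ C` needs no Jacobian of the Gram map: up to explicit determinant weights, both
measures on the cone are invariant under `X ↦ T X Tᴴ`, and such a measure is unique up to a factor
(`IsConeInvariant.lintegral_eq_const_mul`). No constant is computed; the test function `1` fixes the
normalization at the end. Working in `ENNReal` until then makes integrability of the density a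
consequence. -/

noncomputable section

namespace HeisenbergConvolution

/-! ### Lebesgue measure on complex matrices -/

section Instances

variable {m n : Type*}

instance : MeasurableSpace (Matrix m n ℂ) := inferInstanceAs (MeasurableSpace (m → n → ℂ))

instance [Fintype m] [Fintype n] : SecondCountableTopology (Matrix m n ℂ) :=
  inferInstanceAs (SecondCountableTopology (m → n → ℂ))

instance [Fintype m] [Fintype n] : BorelSpace (Matrix m n ℂ) :=
  inferInstanceAs (BorelSpace (m → n → ℂ))

instance [Fintype m] [Fintype n] : MeasureSpace (Matrix m n ℂ) where
  volume := (volume : Measure (m → n → ℂ))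

instance [Fintype m] [Fintype n] : SigmaFinite (volume : Measure (Matrix m n ℂ)) :=
  inferInstanceAs (SigmaFinite (volume : Measure (m → n → ℂ)))

/-- General `E` covers both complex matrices and the real coordinates of Hermitian matrices. -/
instance isAddHaarMeasure_volume_pi_pi {E : Type*} [NormedAddCommGroup E] [NormedSpace ℝ E]
    [FiniteDimensional ℝ E] [MeasureSpace E] [BorelSpace E]
    [(volume : Measure E).IsAddHaarMeasure] [Fintype m] [Fintype n] :
    (volume : Measure (m → n → E)).IsAddHaarMeasure := by
  have : (volume : Measure (n → E)).IsAddHaarMeasure :=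
    inferInstanceAs ((Measure.pi fun _ : n => (volume : Measure E)).IsAddHaarMeasure)
  exact Measure.pi.isAddHaarMeasure fun _ : m => (volume : Measure (n → E))

instance [Fintype m] [Fintype n] :
    (volume : Measure (Matrix m n ℂ)).IsOpenPosMeasure :=
  inferInstanceAs ((volume : Measure (m → n → ℂ)).IsOpenPosMeasure)

end Instances

theorem lintegral_eq_enorm_det_mul_lintegral_comp {E : Type*} [NormedAddCommGroup E]
    [NormedSpace ℝ E] [MeasurableSpace E] [BorelSpace E] [FiniteDimensional ℝ E] (μ : Measure E)
    [μ.IsAddHaarMeasure] {f : E →ₗ[ℝ] E} (hf : LinearMap.det f ≠ 0) {F : E → ENNReal}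
    (hF : Measurable F) :
    ∫⁻ x, F x ∂μ = ‖LinearMap.det f‖ₑ * ∫⁻ x, F (f x) ∂μ := by
  have hfm : Measurable f := f.continuous_of_finiteDimensional.measurable
  rw [← lintegral_map hF hfm, Measure.map_linearMap_addHaar_eq_smul_addHaar μ hf,
    lintegral_smul_measure, smul_eq_mul, ← mul_assoc, ← Real.enorm_eq_ofReal_abs, ← enorm_mul,
    mul_inv_cancel₀ hf, enorm_one, one_mul]

/-- The map `Z ↦ A Z B` on complex matrices. -/
def mulMulLin {m n : Type*} [Fintype m] [Fintype n] (A : Matrix m m ℂ) (B : Matrix n n ℂ) :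
    Matrix m n ℂ →ₗ[ℂ] Matrix m n ℂ where
  toFun Z := A * Z * B
  map_add' X Y := by rw [Matrix.mul_add, Matrix.add_mul]
  map_smul' c X := by rw [Matrix.mul_smul, Matrix.smul_mul]; rfl

section

variable {m n : Type*} [Fintype m] [Fintype n] [DecidableEq m] [DecidableEq n]

/-- After vectorization the map is the Kronecker product of `Bᵀ` and `A`. -/
theorem det_mulMulLin (A : Matrix m m ℂ) (B : Matrix n n ℂ) :
    LinearMap.det (mulMulLin A B) = A.det ^ Fintype.card n * B.det ^ Fintype.card m := by
  let e : Matrix m n ℂ ≃ₗ[ℂ] (n × m → ℂ) :=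
    LinearEquiv.ofBijective
      { toFun := vec, map_add' := vec_add, map_smul' := vec_smul } vec_bijective
  have h : (e : Matrix m n ℂ →ₗ[ℂ] (n × m → ℂ)) ∘ₗ mulMulLin A B ∘ₗ e.symm =
      Matrix.toLin' (kroneckerMap (· * ·) Bᵀ A) := by
    ext1 i
    ext1
    obtain ⟨X, hX⟩ := e.surjective (Pi.single i 1)
    simp only [LinearMap.comp_apply, LinearMap.coe_single, LinearEquiv.coe_coe]
    rw [← hX, LinearEquiv.symm_apply_apply]
    change vec (A * X * B) = kroneckerMap (· * ·) Bᵀ A *ᵥ vec X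
    rw [kronecker_mulVec_vec, transpose_transpose]
  rw [← LinearMap.det_conj _ e, h, LinearMap.det_toLin', det_kronecker, det_transpose, mul_comm]

/-- The real determinant of a complex linear map is the squared modulus of its complex determinant;
this is the source of the exponents `2 * q` below. -/
theorem det_restrictScalars_mulMulLin (A : Matrix m m ℂ) (B : Matrix n n ℂ) :
    LinearMap.det ((mulMulLin A B).restrictScalars ℝ) =
      (‖A.det‖ ^ Fintype.card n * ‖B.det‖ ^ Fintype.card m) ^ 2 := by
  rw [LinearMap.det_restrictScalars, Algebra.norm_complex_eq, det_mulMulLin]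
  simp [Complex.normSq_eq_norm_sq, mul_pow]

theorem lintegral_mul_mul {A : Matrix m m ℂ} {B : Matrix n n ℂ} (hA : A.det ≠ 0)
    (hB : B.det ≠ 0) {F : Matrix m n ℂ → ENNReal} (hF : Measurable F) :
    ∫⁻ Z, F Z = (‖A.det‖ₑ ^ Fintype.card n * ‖B.det‖ₑ ^ Fintype.card m) ^ 2 *
      ∫⁻ Z : Matrix m n ℂ, F (A * Z * B) := by
  have hdet := det_restrictScalars_mulMulLin A B
  let f : (m → n → ℂ) →ₗ[ℝ] (m → n → ℂ) := (mulMulLin A B).restrictScalars ℝ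
  have hf : LinearMap.det f = (‖A.det‖ ^ Fintype.card n * ‖B.det‖ ^ Fintype.card m) ^ 2 := hdet
  have hne : LinearMap.det f ≠ 0 := by rw [hf]; positivity
  have key := lintegral_eq_enorm_det_mul_lintegral_comp (volume : Measure (m → n → ℂ)) hne hF
  rw [hf] at key
  simp only [enorm_pow, enorm_mul, enorm_norm] at key
  exact key

theorem lintegral_mul_right {B : Matrix n n ℂ} (hB : B.det ≠ 0) {F : Matrix m n ℂ → ENNReal}
    (hF : Measurable F) :
    ∫⁻ Z, F Z = ‖B.det‖ₑ ^ (2 * Fintype.card m) * ∫⁻ Z : Matrix m n ℂ, F (Z * B) := by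
  have := lintegral_mul_mul (A := (1 : Matrix m m ℂ)) (by simp) hB hF
  simpa [← pow_mul, mul_comm] using this

theorem lintegral_mul_left {A : Matrix m m ℂ} (hA : A.det ≠ 0) {F : Matrix m n ℂ → ENNReal}
    (hF : Measurable F) :
    ∫⁻ Z, F Z = ‖A.det‖ₑ ^ (2 * Fintype.card n) * ∫⁻ Z : Matrix m n ℂ, F (A * Z) := by
  have := lintegral_mul_mul (B := (1 : Matrix n n ℂ)) hA (by simp) hF
  simpa [← pow_mul, mul_comm] using this

end

/-! ### Lebesgue measure on Hermitian matrices -/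

section Hermitian

variable {q : ℕ}

/-- A linear parametrization of the Hermitian matrices by the real matrices; its inverse is
`X ↦ Re X + Im X`. -/
def hermLin (q : ℕ) : (Fin q → Fin q → ℝ) →ₗ[ℝ] Matrix (Fin q) (Fin q) ℂ where
  toFun S := Matrix.of fun i j => ⟨(S i j + S j i) / 2, (S i j - S j i) / 2⟩
  map_add' S T := by
    ext i j
    apply Complex.ext <;> simp <;> ring
  map_smul' c S := by
    ext i j
    apply Complex.ext <;> simp <;> ring

/-- The real matrix `Re X + Im X`. -/
def hermCoord (q : ℕ) : Matrix (Fin q) (Fin q) ℂ →ₗ[ℝ] (Fin q → Fin q → ℝ) where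
  toFun X := fun i j => (X i j).re + (X i j).im
  map_add' S T := by
    ext i j
    simp; ring
  map_smul' c S := by
    ext i j
    simp; ring

theorem hermCoord_hermLin (S : Fin q → Fin q → ℝ) : hermCoord q (hermLin q S) = S := by
  ext i j
  simp [hermCoord, hermLin]; ring

theorem isHermitian_hermLin (S : Fin q → Fin q → ℝ) : (hermLin q S).IsHermitian := by
  ext i j
  apply Complex.ext <;> simp [hermLin] <;> ring

theorem hermLin_hermCoord {X : Matrix (Fin q) (Fin q) ℂ} (hX : X.IsHermitian) :
    hermLin q (hermCoord q X) = X := by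
  ext i j
  have h := hX.apply i j
  have h1 : (X j i).re = (X i j).re := by rw [← h]; simp
  have h2 : (X j i).im = -(X i j).im := by rw [← h]; simp
  apply Complex.ext <;> (simp [hermLin, hermCoord, h1, h2]; try ring)

theorem continuous_hermLin : Continuous (hermLin q) := by
  refine continuous_matrix fun i j => ?_
  have : (fun S : Fin q → Fin q → ℝ => hermLin q S i j) =
      fun S => (((S i j + S j i) / 2 : ℝ) : ℂ) + (((S i j - S j i) / 2 : ℝ) : ℂ) * Complex.I := by
    ext S
    exact Complex.mk_eq_add_mul_I _ _
  rw [this]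
  fun_prop

theorem measurable_hermLin : Measurable (hermLin q) := continuous_hermLin.measurable

/-- Lebesgue measure on the Hermitian matrices, as a measure on all matrices. -/
def hermVolume (q : ℕ) : Measure (Matrix (Fin q) (Fin q) ℂ) := Measure.map (hermLin q) volume

instance : SFinite (hermVolume q) := by unfold hermVolume; infer_instance

theorem lintegral_hermVolume {F : Matrix (Fin q) (Fin q) ℂ → ENNReal} (hF : Measurable F) :
    ∫⁻ X, F X ∂(hermVolume q) = ∫⁻ S, F (hermLin q S) :=
  lintegral_map hF measurable_hermLin

theorem lintegral_hermVolume_add {A : Matrix (Fin q) (Fin q) ℂ} (hA : A.IsHermitian)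
    {F : Matrix (Fin q) (Fin q) ℂ → ENNReal} (hF : Measurable F) :
    ∫⁻ X, F (A + X) ∂(hermVolume q) = ∫⁻ X, F X ∂(hermVolume q) := by
  have hm : Measurable fun X : Matrix (Fin q) (Fin q) ℂ => F (A + X) :=
    hF.comp (by fun_prop : Continuous fun X : Matrix (Fin q) (Fin q) ℂ => A + X).measurable
  rw [lintegral_hermVolume hF, lintegral_hermVolume hm,
    ← lintegral_add_left_eq_self (fun S => F (hermLin q S)) (hermCoord q A)]
  simp [hermLin_hermCoord hA]

/-- The map `X ↦ Tᴴ X T` in the coordinates `hermCoord`. -/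
def congrCoord (T : Matrix (Fin q) (Fin q) ℂ) : (Fin q → Fin q → ℝ) →ₗ[ℝ] (Fin q → Fin q → ℝ) :=
  hermCoord q ∘ₗ (mulMulLin Tᴴ T).restrictScalars ℝ ∘ₗ hermLin q

theorem hermLin_congrCoord (T : Matrix (Fin q) (Fin q) ℂ) (S : Fin q → Fin q → ℝ) :
    hermLin q (congrCoord T S) = Tᴴ * hermLin q S * T :=
  hermLin_hermCoord (isHermitian_conjTranspose_mul_mul T (isHermitian_hermLin S))

/-- The decomposition of a complex matrix into its Hermitian and skew-Hermitian parts. -/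
def hermProdEquiv (q : ℕ) :
    ((Fin q → Fin q → ℝ) × (Fin q → Fin q → ℝ)) ≃ₗ[ℝ] Matrix (Fin q) (Fin q) ℂ :=
  LinearEquiv.ofBijective
    (LinearMap.coprod (hermLin q) (Complex.I • hermLin q)) (by
      have hker : Function.Injective (LinearMap.coprod (hermLin q) (Complex.I • hermLin q)) := by
        rw [← LinearMap.ker_eq_bot, LinearMap.ker_eq_bot']
        rintro ⟨S, T⟩ h
        have h1 : hermLin q S + Complex.I • hermLin q T = 0 := by simpa using h
        -- Conjugate transposition fixes both Hermitian matrices and changes the sign of `I`, so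
        -- both parts vanish. Surjectivity then follows since both sides have real dimension `2q²`.
        have h2 : hermLin q S - Complex.I • hermLin q T = 0 := by
          have := congrArg conjTranspose h1
          simpa [(isHermitian_hermLin S).eq, (isHermitian_hermLin T).eq, sub_eq_add_neg] using this
        have hS : hermLin q S = 0 := by
          have := congrArg₂ (· + ·) h1 h2
          simp only [add_add_sub_cancel, add_zero] at this
          rw [← two_smul ℂ] at this
          simpa using this
        have hT : hermLin q T = 0 := by
          rw [hS, zero_add] at h1
          simpa using h1
        rw [← hermCoord_hermLin S, ← hermCoord_hermLin T, hS, hT]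
        simp
      refine ⟨hker, ?_⟩
      refine (LinearMap.injective_iff_surjective_of_finrank_eq_finrank ?_).mp hker
      rw [Module.finrank_prod, ← Module.finrank_mul_finrank ℝ ℂ (Matrix (Fin q) (Fin q) ℂ)]
      simp [Module.finrank_matrix, Module.finrank_pi_fintype]
      ring)

theorem hermProdEquiv_apply (S T : Fin q → Fin q → ℝ) :
    hermProdEquiv q (S, T) = hermLin q S + Complex.I • hermLin q T := rfl

/-- Congruence acts in the same way on the Hermitian and the skew-Hermitian part of a complex
matrix. The square of the wanted determinant is thus the real determinant of `Z ↦ Tᴴ Z T`, which is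
already known. -/
theorem abs_det_congrCoord (T : Matrix (Fin q) (Fin q) ℂ) :
    |LinearMap.det (congrCoord T)| = ‖T.det‖ ^ (2 * q) := by
  have h1 : (hermProdEquiv q : _ →ₗ[ℝ] Matrix (Fin q) (Fin q) ℂ) ∘ₗ
      (LinearMap.prodMap (congrCoord T) (congrCoord T)) ∘ₗ (hermProdEquiv q).symm =
      (mulMulLin Tᴴ T).restrictScalars ℝ := by
    ext1 X
    obtain ⟨⟨S, S'⟩, rfl⟩ := (hermProdEquiv q).surjective X
    simp only [LinearMap.comp_apply, LinearEquiv.coe_coe]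
    rw [LinearEquiv.symm_apply_apply, LinearMap.prodMap_apply, hermProdEquiv_apply,
      hermProdEquiv_apply]
    simp [hermLin_congrCoord, mulMulLin, Matrix.mul_add, Matrix.add_mul]
  have h2 := congrArg LinearMap.det h1
  rw [LinearMap.det_conj, LinearMap.det_prodMap, det_restrictScalars_mulMulLin] at h2
  rw [← abs_of_nonneg (show 0 ≤ ‖T.det‖ ^ (2 * q) by positivity), ← sq_eq_sq_iff_abs_eq_abs, sq, h2]
  simp [det_conjTranspose]
  ring

theorem lintegral_hermVolume_congr {T : Matrix (Fin q) (Fin q) ℂ} (hT : T.det ≠ 0)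
    {F : Matrix (Fin q) (Fin q) ℂ → ENNReal} (hF : Measurable F) :
    ∫⁻ X, F X ∂(hermVolume q) =
      ‖T.det‖ₑ ^ (2 * q) * ∫⁻ X, F (Tᴴ * X * T) ∂(hermVolume q) := by
  have hdet := abs_det_congrCoord T
  have hne : LinearMap.det (congrCoord T) ≠ 0 := by
    rw [← abs_pos, hdet]; positivity
  have hen : ‖LinearMap.det (congrCoord T)‖ₑ = ‖T.det‖ₑ ^ (2 * q) := by
    rw [Real.enorm_eq_ofReal_abs, hdet, ENNReal.ofReal_pow (norm_nonneg _), ofReal_norm]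
  have hm : Measurable fun X : Matrix (Fin q) (Fin q) ℂ => F (Tᴴ * X * T) :=
    hF.comp (by fun_prop : Continuous fun X : Matrix (Fin q) (Fin q) ℂ => Tᴴ * X * T).measurable
  rw [lintegral_hermVolume hF, lintegral_hermVolume hm,
    lintegral_eq_enorm_det_mul_lintegral_comp volume hne
      (F := fun S => F (hermLin q S)) (hF.comp measurable_hermLin), hen]
  simp only [hermLin_congrCoord]

end Hermitian

/-! ### The cone of positive definite matrices -/

section PosDef

variable {q : ℕ}

theorem isClosed_posSemidef (q : ℕ) :
    IsClosed {X : Matrix (Fin q) (Fin q) ℂ | X.PosSemidef} := by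
  have : {X : Matrix (Fin q) (Fin q) ℂ | X.PosSemidef} =
      {X | Xᴴ = X} ∩ ⋂ v : Fin q → ℂ, {X | 0 ≤ star v ⬝ᵥ (X *ᵥ v)} := by
    ext X
    simp only [Set.mem_ofPred_eq, Set.mem_inter_iff, Set.mem_iInter]
    exact posSemidef_iff_dotProduct_mulVec
  rw [this]
  refine (isClosed_eq (by fun_prop) continuous_id).inter (isClosed_iInter fun v => ?_)
  exact isClosed_le continuous_const
    (continuous_const.dotProduct (Continuous.matrix_mulVec continuous_id continuous_const))

/-- The set of positive definite matrices. -/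
def posDefSet (q : ℕ) : Set (Matrix (Fin q) (Fin q) ℂ) := {X | X.PosDef}

theorem measurable_det : Measurable fun X : Matrix (Fin q) (Fin q) ℂ => X.det :=
  (continuous_id.matrix_det).measurable

theorem measurableSet_posDefSet (q : ℕ) : MeasurableSet (posDefSet q) := by
  have : posDefSet q = {X | X.PosSemidef} ∩ {X | X.det ≠ 0} := by
    ext X
    refine ⟨fun h => ⟨h.posSemidef, h.det_pos.ne'⟩, fun h => ?_⟩
    exact h.1.posDef_iff_det_ne_zero.mpr h.2
  rw [this]
  exact (isClosed_posSemidef q).measurableSet.inter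
    (measurable_det (measurableSet_singleton 0).compl)

theorem measurable_inv_matrix : Measurable fun X : Matrix (Fin q) (Fin q) ℂ => X⁻¹ := by
  have : (fun X : Matrix (Fin q) (Fin q) ℂ => X⁻¹) = fun X => (X.det)⁻¹ • X.adjugate := by
    ext1 X
    rw [inv_def, Ring.inverse_eq_inv']
  rw [this]
  refine measurable_pi_lambda _ fun i => measurable_pi_lambda _ fun j => ?_
  have h : Measurable fun X : Matrix (Fin q) (Fin q) ℂ => X.adjugate i j :=
    ((continuous_id.matrix_adjugate).matrix_elem i j).measurable
  exact measurable_det.inv.mul h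

theorem posDef_mul_mul_conjTranspose_iff {T X : Matrix (Fin q) (Fin q) ℂ} (hT : T.det ≠ 0) :
    (T * X * Tᴴ).PosDef ↔ X.PosDef :=
  IsUnit.posDef_star_right_conjugate_iff ((isUnit_iff_isUnit_det T).mpr hT.isUnit)

section Sqrt

variable {X : Matrix (Fin q) (Fin q) ℂ}

theorem posSemidef_sqrt : (CFC.sqrt X).PosSemidef :=
  nonneg_iff_posSemidef.mp (CFC.sqrt_nonneg X)

theorem conjTranspose_sqrt : (CFC.sqrt X)ᴴ = CFC.sqrt X := posSemidef_sqrt.isHermitian.eq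

theorem sqrt_mul_sqrt (hX : X.PosSemidef) : CFC.sqrt X * CFC.sqrt X = X :=
  CFC.sqrt_mul_sqrt_self X (nonneg_iff_posSemidef.mpr hX)

theorem det_sqrt_mul_det_sqrt (hX : X.PosSemidef) :
    (CFC.sqrt X).det * (CFC.sqrt X).det = X.det := by
  rw [← det_mul, sqrt_mul_sqrt hX]

theorem det_sqrt_ne_zero (hX : X.PosDef) : (CFC.sqrt X).det ≠ 0 := by
  intro h
  have := det_sqrt_mul_det_sqrt hX.posSemidef
  rw [h, zero_mul] at this
  exact hX.det_pos.ne this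

end Sqrt

end PosDef

/-! ### The invariant measure on the general linear group -/

section GeneralLinear

variable {q : ℕ}

/-- The density of the Haar measure of `GL_q(ℂ)` with respect to Lebesgue measure. -/
def glWeight (T : Matrix (Fin q) (Fin q) ℂ) : ENNReal :=
  -- The indicator avoids the value `⊤` of `0⁻¹` and makes singular matrices null by construction.
  {T : Matrix (Fin q) (Fin q) ℂ | T.det ≠ 0}.indicator (fun T => (‖T.det‖ₑ⁻¹) ^ (2 * q)) T

theorem measurableSet_det_ne_zero (q : ℕ) :
    MeasurableSet {T : Matrix (Fin q) (Fin q) ℂ | T.det ≠ 0} :=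
  measurable_det (measurableSet_singleton 0).compl

theorem measurable_glWeight : Measurable (glWeight (q := q)) := by
  refine Measurable.indicator ?_ (measurableSet_det_ne_zero q)
  exact (measurable_det.enorm.inv).pow_const _

theorem glWeight_mul {A T : Matrix (Fin q) (Fin q) ℂ} (hA : A.det ≠ 0) :
    ‖A.det‖ₑ ^ (2 * q) * glWeight (A * T) = glWeight T := by
  unfold glWeight
  by_cases hT : T.det = 0
  · simp [hT, Set.indicator]
  · have h : (A * T).det ≠ 0 := by simp [hA, hT]
    have hA' : ‖A.det‖ₑ ≠ 0 := by simpa using hA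
    rw [Set.indicator_of_mem (by exact h), Set.indicator_of_mem (by exact hT), det_mul, enorm_mul,
      ENNReal.mul_inv (Or.inl hA') (Or.inl enorm_ne_top), mul_pow, ← mul_assoc, ← mul_pow,
      ENNReal.mul_inv_cancel hA' enorm_ne_top, one_pow, one_mul]

theorem glWeight_mul' {A T : Matrix (Fin q) (Fin q) ℂ} (hA : A.det ≠ 0) :
    ‖A.det‖ₑ ^ (2 * q) * glWeight (T * A) = glWeight T := by
  have h : glWeight (T * A) = glWeight (A * T) := by
    simp only [glWeight, Set.indicator, Set.mem_ofPred_eq, det_mul, mul_comm]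
  rw [h, glWeight_mul hA]

/-- The Haar measure of `GL_q(ℂ)`, as a measure on all matrices. -/
def glHaar (q : ℕ) : Measure (Matrix (Fin q) (Fin q) ℂ) := volume.withDensity glWeight

instance : SFinite (glHaar q) := by unfold glHaar; infer_instance

theorem lintegral_glHaar {F : Matrix (Fin q) (Fin q) ℂ → ENNReal} (hF : Measurable F) :
    ∫⁻ T, F T ∂(glHaar q) = ∫⁻ T, glWeight T * F T :=
  lintegral_withDensity_eq_lintegral_mul _ measurable_glWeight hF

theorem ae_glHaar_det_ne_zero : ∀ᵐ T ∂(glHaar q), T.det ≠ 0 := by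
  rw [glHaar, ae_withDensity_iff measurable_glWeight]
  refine Filter.Eventually.of_forall fun T hT h => hT ?_
  simp [glWeight, Set.indicator, h]

theorem lintegral_glHaar_mul_left {A : Matrix (Fin q) (Fin q) ℂ} (hA : A.det ≠ 0)
    {F : Matrix (Fin q) (Fin q) ℂ → ENNReal} (hF : Measurable F) :
    ∫⁻ T, F (A * T) ∂(glHaar q) = ∫⁻ T, F T ∂(glHaar q) := by
  have hc : Measurable fun T : Matrix (Fin q) (Fin q) ℂ => A * T :=
    (by fun_prop : Continuous fun T : Matrix (Fin q) (Fin q) ℂ => A * T).measurable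
  have hm : Measurable fun T => F (A * T) := hF.comp hc
  rw [lintegral_glHaar hF, lintegral_glHaar hm,
    lintegral_mul_left hA (F := fun T => glWeight T * F T) (measurable_glWeight.mul hF), Fintype.card_fin, ← lintegral_const_mul]
  · simp only [← mul_assoc, glWeight_mul hA]
  · exact (measurable_glWeight.mul hF).comp hc

theorem lintegral_glHaar_mul_right {A : Matrix (Fin q) (Fin q) ℂ} (hA : A.det ≠ 0)
    {F : Matrix (Fin q) (Fin q) ℂ → ENNReal} (hF : Measurable F) :
    ∫⁻ T, F (T * A) ∂(glHaar q) = ∫⁻ T, F T ∂(glHaar q) := by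
  have hc : Measurable fun T : Matrix (Fin q) (Fin q) ℂ => T * A :=
    (by fun_prop : Continuous fun T : Matrix (Fin q) (Fin q) ℂ => T * A).measurable
  have hm : Measurable fun T => F (T * A) := hF.comp hc
  rw [lintegral_glHaar hF, lintegral_glHaar hm,
    lintegral_mul_right hA (F := fun T => glWeight T * F T) (measurable_glWeight.mul hF), Fintype.card_fin, ← lintegral_const_mul]
  · simp only [← mul_assoc, glWeight_mul' hA]
  · exact (measurable_glWeight.mul hF).comp hc

end GeneralLinear

/-! ### Uniqueness of invariant measures on the cone -/

section Unique

variable {q : ℕ}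

/-- A measure that lives on the positive definite matrices and is invariant under `X ↦ T X Tᴴ`. -/
structure IsConeInvariant (ν : Measure (Matrix (Fin q) (Fin q) ℂ)) : Prop where
  ae_posDef : ∀ᵐ X ∂ν, X.PosDef
  lintegral_comp_conj : ∀ {T : Matrix (Fin q) (Fin q) ℂ}, T.det ≠ 0 →
    ∀ {F : Matrix (Fin q) (Fin q) ℂ → ENNReal}, Measurable F →
      ∫⁻ X, F (T * X * Tᴴ) ∂ν = ∫⁻ X, F X ∂ν

theorem measurable_mul_mul_conjTranspose :
    Measurable fun p : Matrix (Fin q) (Fin q) ℂ × Matrix (Fin q) (Fin q) ℂ =>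
      p.2 * p.1 * p.2ᴴ :=
  (by fun_prop : Continuous fun p : Matrix (Fin q) (Fin q) ℂ × Matrix (Fin q) (Fin q) ℂ =>
    p.2 * p.1 * p.2ᴴ).measurable

theorem measurable_inv_mul_mul_conjTranspose :
    Measurable fun p : Matrix (Fin q) (Fin q) ℂ × Matrix (Fin q) (Fin q) ℂ =>
      p.2⁻¹ * p.1 * (p.2⁻¹)ᴴ := by
  have h : Measurable fun p : Matrix (Fin q) (Fin q) ℂ × Matrix (Fin q) (Fin q) ℂ =>
      (p.1, p.2⁻¹) :=
    measurable_fst.prodMk (measurable_inv_matrix.comp measurable_snd)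
  exact Measurable.comp (f := fun p : Matrix (Fin q) (Fin q) ℂ × Matrix (Fin q) (Fin q) ℂ =>
    (p.1, p.2⁻¹)) measurable_mul_mul_conjTranspose h

/-- Both sides equal the double integral of `f X * g (T X Tᴴ)`. Right translation of `T` by `√X`
produces it from the left side; after exchanging the integrals, invariance of `ν` moves `T` from `g`
to `f`, and left translation by `(√X)⁻¹` removes `X` from `f`. Unimodularity of `GL_q` is essential.
-/
theorem IsConeInvariant.lintegral_mul_lintegral {ν : Measure (Matrix (Fin q) (Fin q) ℂ)}
    [SFinite ν] (hν : IsConeInvariant ν) {f g : Matrix (Fin q) (Fin q) ℂ → ENNReal}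
    (hf : Measurable f) (hg : Measurable g) :
    (∫⁻ X, f X ∂ν) * (∫⁻ T, g (T * Tᴴ) ∂(glHaar q)) =
      (∫⁻ X, g X ∂ν) * (∫⁻ T, f (T⁻¹ * (T⁻¹)ᴴ) ∂(glHaar q)) := by
  have hcongr := measurable_mul_mul_conjTranspose (q := q)
  have hsq : Measurable fun T : Matrix (Fin q) (Fin q) ℂ => T * Tᴴ :=
    (by fun_prop : Continuous fun T : Matrix (Fin q) (Fin q) ℂ => T * Tᴴ).measurable
  have hcongr' := measurable_inv_mul_mul_conjTranspose (q := q)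
  have hg₁ (X : Matrix (Fin q) (Fin q) ℂ) : Measurable fun T => g (T * X * Tᴴ) := by
    have := hg.comp (hcongr.comp (measurable_prodMk_left (x := X)))
    exact this
  have hf₁ (X : Matrix (Fin q) (Fin q) ℂ) : Measurable fun T => f (T⁻¹ * X * (T⁻¹)ᴴ) := by
    have := hf.comp (hcongr'.comp (measurable_prodMk_left (x := X)))
    exact this
  have hf₂ (T : Matrix (Fin q) (Fin q) ℂ) : Measurable fun X => f (T⁻¹ * X * (T⁻¹)ᴴ) := by
    have := hf.comp (hcongr'.comp (measurable_prodMk_right (y := T)))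
    exact this
  have hf₃ : Measurable fun T : Matrix (Fin q) (Fin q) ℂ => f (T⁻¹ * (T⁻¹)ᴴ) := by
    have := (hf.comp hsq).comp measurable_inv_matrix
    exact this
  calc (∫⁻ X, f X ∂ν) * (∫⁻ T, g (T * Tᴴ) ∂(glHaar q))
      = ∫⁻ X, f X * ∫⁻ T, g (T * Tᴴ) ∂(glHaar q) ∂ν := (lintegral_mul_const _ hf).symm
    _ = ∫⁻ X, ∫⁻ T, f X * g (T * X * Tᴴ) ∂(glHaar q) ∂ν := by
        refine lintegral_congr_ae ?_
        filter_upwards [hν.ae_posDef] with X hX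
        rw [lintegral_const_mul _ (hg₁ X)]
        congr 1
        rw [← lintegral_glHaar_mul_right (det_sqrt_ne_zero hX) (F := fun T => g (T * Tᴴ))
          (hg.comp hsq)]
        refine lintegral_congr fun T => ?_
        rw [conjTranspose_mul, conjTranspose_sqrt, Matrix.mul_assoc, ← Matrix.mul_assoc _ _ Tᴴ,
          sqrt_mul_sqrt hX.posSemidef, Matrix.mul_assoc]
    _ = ∫⁻ T, ∫⁻ X, f X * g (T * X * Tᴴ) ∂ν ∂(glHaar q) := by
        refine lintegral_lintegral_swap ?_
        exact ((hf.comp measurable_fst).mul (hg.comp hcongr)).aemeasurable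
    _ = ∫⁻ T, ∫⁻ X, g X * f (T⁻¹ * X * (T⁻¹)ᴴ) ∂ν ∂(glHaar q) := by
        refine lintegral_congr_ae ?_
        filter_upwards [ae_glHaar_det_ne_zero] with T hT
        rw [← hν.lintegral_comp_conj hT (F := fun X => g X * f (T⁻¹ * X * (T⁻¹)ᴴ))
          (hg.mul (hf₂ T))]
        refine lintegral_congr fun X => ?_
        have h1 : T⁻¹ * T = 1 := nonsing_inv_mul T hT.isUnit
        have h2 : Tᴴ * (T⁻¹)ᴴ = 1 := by rw [← conjTranspose_mul, h1, conjTranspose_one]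
        have h3 : T⁻¹ * (T * X * Tᴴ) * (T⁻¹)ᴴ = X := by
          rw [Matrix.mul_assoc T, ← Matrix.mul_assoc T⁻¹, h1, Matrix.one_mul, Matrix.mul_assoc, h2,
            Matrix.mul_one]
        rw [h3, mul_comm]
    _ = ∫⁻ X, ∫⁻ T, g X * f (T⁻¹ * X * (T⁻¹)ᴴ) ∂(glHaar q) ∂ν := by
        refine (lintegral_lintegral_swap ?_).symm
        exact ((hg.comp measurable_fst).mul (hf.comp hcongr')).aemeasurable
    _ = ∫⁻ X, g X * ∫⁻ T, f (T⁻¹ * (T⁻¹)ᴴ) ∂(glHaar q) ∂ν := by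
        refine lintegral_congr_ae ?_
        filter_upwards [hν.ae_posDef] with X hX
        rw [lintegral_const_mul _ (hf₁ X)]
        congr 1
        have hS := det_sqrt_ne_zero hX
        have hS' : ((CFC.sqrt X)⁻¹).det ≠ 0 := by
          rw [det_nonsing_inv, Ring.inverse_eq_inv']; exact inv_ne_zero hS
        rw [← lintegral_glHaar_mul_left hS' (F := fun T => f (T⁻¹ * (T⁻¹)ᴴ))
          hf₃]
        refine lintegral_congr fun T => ?_
        rw [Matrix.mul_inv_rev, nonsing_inv_nonsing_inv _ hS.isUnit, conjTranspose_mul,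
          conjTranspose_sqrt, Matrix.mul_assoc, Matrix.mul_assoc, ← Matrix.mul_assoc (CFC.sqrt X),
          sqrt_mul_sqrt hX.posSemidef]
    _ = (∫⁻ X, g X ∂ν) * (∫⁻ T, f (T⁻¹ * (T⁻¹)ᴴ) ∂(glHaar q)) := lintegral_mul_const _ hg

/-- In `lintegral_mul_lintegral` the two integrals against `glHaar` do not involve `ν`. Comparing
the identities for `ν₁` and `ν₂` with one test function `g` of finite nonzero integral eliminates
them. -/
theorem IsConeInvariant.lintegral_eq_const_mul {ν₁ ν₂ : Measure (Matrix (Fin q) (Fin q) ℂ)}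
    [SFinite ν₁] [SFinite ν₂] (h₁ : IsConeInvariant ν₁) (h₂ : IsConeInvariant ν₂)
    {g : Matrix (Fin q) (Fin q) ℂ → ENNReal} (hg : Measurable g)
    (hg0 : ∫⁻ T, g (T * Tᴴ) ∂(glHaar q) ≠ 0) (hgt : ∫⁻ T, g (T * Tᴴ) ∂(glHaar q) ≠ ⊤)
    (hν0 : ∫⁻ X, g X ∂ν₂ ≠ 0) (hνt : ∫⁻ X, g X ∂ν₂ ≠ ⊤)
    {f : Matrix (Fin q) (Fin q) ℂ → ENNReal} (hf : Measurable f) :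
    ∫⁻ X, f X ∂ν₁ = (∫⁻ X, g X ∂ν₁) / (∫⁻ X, g X ∂ν₂) * ∫⁻ X, f X ∂ν₂ := by
  have e₁ := h₁.lintegral_mul_lintegral hf hg
  have e₂ := h₂.lintegral_mul_lintegral hf hg
  set a := ∫⁻ T, g (T * Tᴴ) ∂(glHaar q)
  set b := ∫⁻ X, g X ∂ν₂
  set d := ∫⁻ T, f (T⁻¹ * (T⁻¹)ᴴ) ∂(glHaar q)
  have hd : d = (∫⁻ X, f X ∂ν₂) * a / b := by
    rw [e₂, mul_comm, ENNReal.mul_div_cancel_right hν0 hνt]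
  rw [← ENNReal.mul_left_inj hg0 hgt, e₁, hd]
  simp only [div_eq_mul_inv]
  ring

end Unique

/-! ### Continuity and measurability of the square root -/

section Sqrt

open scoped Matrix.Norms.L2Operator

theorem continuousOn_sqrt (q : ℕ) :
    ContinuousOn (CFC.sqrt : Matrix (Fin q) (Fin q) ℂ → Matrix (Fin q) (Fin q) ℂ) {X | 0 ≤ X} :=
  CFC.continuousOn_sqrt

/-- With `ε = ‖1 - X‖ < 1`, write `X = (1 - ε) 1 + (ε 1 - (1 - X))`: a positive definite plus a
positive semidefinite matrix. -/
theorem eventually_posDef_one (q : ℕ) :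
    ∀ᶠ X in nhds (1 : Matrix (Fin q) (Fin q) ℂ), X.IsHermitian → X.PosDef := by
  have h : ∀ᶠ X in nhds (1 : Matrix (Fin q) (Fin q) ℂ), ‖1 - X‖ < 1 := by
    have hc : Continuous fun X : Matrix (Fin q) (Fin q) ℂ => ‖1 - X‖ := by fun_prop
    exact (hc.tendsto' 1 0 (by simp)).eventually (eventually_lt_nhds one_pos)
  filter_upwards [h] with X hX hX'
  have hs : IsSelfAdjoint (1 - X) := (isHermitian_one.sub hX').isSelfAdjoint
  have h1 : (algebraMap ℝ (Matrix (Fin q) (Fin q) ℂ) ‖1 - X‖ - (1 - X)).PosSemidef :=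
    le_iff.mp hs.le_algebraMap_norm_self
  have h2 : ((1 - ‖1 - X‖) • (1 : Matrix (Fin q) (Fin q) ℂ)).PosDef :=
    PosDef.one.smul (sub_pos.mpr hX)
  have h3 := h2.add_posSemidef h1
  rw [Algebra.algebraMap_eq_smul_one, sub_smul, one_smul] at h3
  convert h3 using 1
  abel

end Sqrt

/-! ### Measurability of the square root, and determinant weights on the positive definite matrices.
-/

section Measurable

variable {q : ℕ}

theorem measurable_sqrt :
    Measurable (CFC.sqrt : Matrix (Fin q) (Fin q) ℂ → Matrix (Fin q) (Fin q) ℂ) := by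
  classical
  have hs : MeasurableSet {X : Matrix (Fin q) (Fin q) ℂ | 0 ≤ X} := by
    simp only [nonneg_iff_posSemidef]
    exact (isClosed_posSemidef q).measurableSet
  have h : (CFC.sqrt : Matrix (Fin q) (Fin q) ℂ → Matrix (Fin q) (Fin q) ℂ) =
      {X | 0 ≤ X}.piecewise CFC.sqrt fun _ => 0 := by
    ext1 X
    by_cases hX : 0 ≤ X
    · exact (Set.piecewise_eq_of_mem {X | 0 ≤ X} _ _ hX).symm
    -- Off the cone the functional calculus takes its default value `0`.
    · exact (cfcₙ_apply_of_not_predicate _ hX).trans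
        (Set.piecewise_eq_of_notMem {X | 0 ≤ X} CFC.sqrt (fun _ => 0) hX).symm
  rw [h]
  exact (continuousOn_sqrt q).measurable_piecewise continuousOn_const hs

/-- The indicator of the positive definite matrices. -/
def pdInd (X : Matrix (Fin q) (Fin q) ℂ) : ENNReal := (posDefSet q).indicator 1 X

theorem measurable_pdInd : Measurable (pdInd (q := q)) :=
  measurable_one.indicator (measurableSet_posDefSet q)

theorem pdInd_of_posDef {X : Matrix (Fin q) (Fin q) ℂ} (hX : X.PosDef) : pdInd X = 1 :=
  Set.indicator_of_mem (s := posDefSet q) hX _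

theorem pdInd_of_not_posDef {X : Matrix (Fin q) (Fin q) ℂ} (hX : ¬X.PosDef) : pdInd X = 0 :=
  Set.indicator_of_notMem (s := posDefSet q) hX _

theorem pdInd_conj {T X : Matrix (Fin q) (Fin q) ℂ} (hT : T.det ≠ 0) :
    pdInd (T * X * Tᴴ) = pdInd X := by
  by_cases hX : X.PosDef
  · rw [pdInd_of_posDef hX, pdInd_of_posDef ((posDef_mul_mul_conjTranspose_iff hT).mpr hX)]
  · rw [pdInd_of_not_posDef hX,
      pdInd_of_not_posDef (mt (posDef_mul_mul_conjTranspose_iff hT).mp hX)]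

theorem enorm_det_conj (T X : Matrix (Fin q) (Fin q) ℂ) :
    ‖(T * X * Tᴴ).det‖ₑ = ‖T.det‖ₑ ^ 2 * ‖X.det‖ₑ := by
  have h : ‖star T.det‖ₑ = ‖T.det‖ₑ := by
    rw [← ofReal_norm, norm_star, ofReal_norm]
  rw [det_mul, det_mul, det_conjTranspose, enorm_mul, enorm_mul, h]
  ring

theorem measurable_enorm_det : Measurable fun X : Matrix (Fin q) (Fin q) ℂ => ‖X.det‖ₑ :=
  measurable_det.enorm

theorem enorm_det_ne_zero {X : Matrix (Fin q) (Fin q) ℂ} (hX : X.PosDef) : ‖X.det‖ₑ ≠ 0 := by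
  simpa using hX.det_pos.ne'

/-- The density `Δ(X)⁻ⁿ` on the positive definite matrices. -/
def pdWeight (n : ℕ) (X : Matrix (Fin q) (Fin q) ℂ) : ENNReal := pdInd X * (‖X.det‖ₑ⁻¹) ^ n

theorem measurable_pdWeight (n : ℕ) : Measurable (pdWeight (q := q) n) :=
  measurable_pdInd.mul (measurable_enorm_det.inv.pow_const n)

/-- The factor `‖det T‖^(2n)` is the Jacobian of `X ↦ T X Tᴴ` on Hermitian matrices for `n = q`, and
of `C ↦ C Tᴴ` on matrices with `n` rows. Both invariant measures on the cone rest on this. -/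
theorem pdWeight_conj (n : ℕ) {T X : Matrix (Fin q) (Fin q) ℂ} (hT : T.det ≠ 0) :
    ‖T.det‖ₑ ^ (2 * n) * pdWeight n (T * X * Tᴴ) = pdWeight n X := by
  have hT' : ‖T.det‖ₑ ≠ 0 := by simpa using hT
  have hT2 : ‖T.det‖ₑ ^ 2 ≠ 0 := pow_ne_zero _ hT'
  have hT3 : ‖T.det‖ₑ ^ 2 ≠ ⊤ := ENNReal.pow_ne_top enorm_ne_top
  rw [pdWeight, pdWeight, pdInd_conj hT, enorm_det_conj, ENNReal.mul_inv (Or.inl hT2) (Or.inl hT3),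
    mul_pow, pow_mul, mul_left_comm, ← mul_assoc (_ ^ n), ← mul_pow,
    ENNReal.mul_inv_cancel hT2 hT3, one_pow, one_mul]

end Measurable

/-! ### Invariant measures on the cone -/

section Cone

variable {q : ℕ}

theorem measurable_gram {m : Type*} [Fintype m] :
    Measurable fun C : Matrix m (Fin q) ℂ => Cᴴ * C :=
  (by fun_prop : Continuous fun C : Matrix m (Fin q) ℂ => Cᴴ * C).measurable

/-- The invariant measure `Δ(X)^{-q} dX` on the cone of positive definite matrices. -/
def coneHaar (q : ℕ) : Measure (Matrix (Fin q) (Fin q) ℂ) :=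
  (hermVolume q).withDensity (pdWeight q)

instance : SFinite (coneHaar q) := by unfold coneHaar; infer_instance

theorem lintegral_coneHaar {F : Matrix (Fin q) (Fin q) ℂ → ENNReal} (hF : Measurable F) :
    ∫⁻ X, F X ∂(coneHaar q) = ∫⁻ X, pdWeight q X * F X ∂(hermVolume q) :=
  lintegral_withDensity_eq_lintegral_mul _ (measurable_pdWeight q) hF

/-- The image of Lebesgue measure under `C ↦ Cᴴ C`, normalized to be invariant. -/
def gramHaar (m : Type*) [Fintype m] (q : ℕ) : Measure (Matrix (Fin q) (Fin q) ℂ) :=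
  ((volume : Measure (Matrix m (Fin q) ℂ)).map fun C => Cᴴ * C).withDensity
    (pdWeight (Fintype.card m))

instance (m : Type*) [Fintype m] : SFinite (gramHaar m q) := by unfold gramHaar; infer_instance

theorem lintegral_gramHaar {m : Type*} [Fintype m] {F : Matrix (Fin q) (Fin q) ℂ → ENNReal}
    (hF : Measurable F) :
    ∫⁻ X, F X ∂(gramHaar m q) =
      ∫⁻ C : Matrix m (Fin q) ℂ, pdWeight (Fintype.card m) (Cᴴ * C) * F (Cᴴ * C) := by
  rw [gramHaar, lintegral_withDensity_eq_lintegral_mul _ (measurable_pdWeight _) hF,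
    lintegral_map ((measurable_pdWeight _).mul hF) measurable_gram]
  rfl

theorem posDef_of_pdWeight_ne_zero {n : ℕ} {X : Matrix (Fin q) (Fin q) ℂ}
    (h : pdWeight n X ≠ 0) : X.PosDef := by
  by_contra hX
  exact h (by rw [pdWeight, pdInd_of_not_posDef hX, zero_mul])

theorem det_conjTranspose_ne_zero {T : Matrix (Fin q) (Fin q) ℂ} (hT : T.det ≠ 0) :
    Tᴴ.det ≠ 0 := by
  rw [det_conjTranspose]
  exact star_ne_zero.mpr hT

theorem enorm_det_conjTranspose (T : Matrix (Fin q) (Fin q) ℂ) : ‖Tᴴ.det‖ₑ = ‖T.det‖ₑ := by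
  rw [det_conjTranspose, ← ofReal_norm, norm_star, ofReal_norm]

theorem isConeInvariant_coneHaar (q : ℕ) : IsConeInvariant (coneHaar q) where
  ae_posDef := by
    rw [coneHaar, ae_withDensity_iff (measurable_pdWeight q)]
    exact Filter.Eventually.of_forall fun X hX => posDef_of_pdWeight_ne_zero hX
  lintegral_comp_conj {T} hT F hF := by
    have hc : Measurable fun X : Matrix (Fin q) (Fin q) ℂ => T * X * Tᴴ :=
      (by fun_prop : Continuous fun X : Matrix (Fin q) (Fin q) ℂ => T * X * Tᴴ).measurable
    have hF' : Measurable fun X => F (T * X * Tᴴ) := hF.comp hc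
    have hG : Measurable fun X => pdWeight q X * F X := (measurable_pdWeight q).mul hF
    have hm : Measurable fun X => pdWeight q (T * X * Tᴴ) * F (T * X * Tᴴ) := hG.comp hc
    rw [lintegral_coneHaar hF',
      lintegral_coneHaar hF,
      lintegral_hermVolume_congr (det_conjTranspose_ne_zero hT) hG, conjTranspose_conjTranspose,
      ← lintegral_const_mul _ hm, enorm_det_conjTranspose]
    simp only [← mul_assoc, pdWeight_conj q hT]

/-- The congruence `X ↦ T X Tᴴ` lifts through the Gram map to right multiplication of `C` by `Tᴴ`.
-/
theorem isConeInvariant_gramHaar (m : Type*) [Fintype m] [DecidableEq m] (q : ℕ) :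
    IsConeInvariant (gramHaar m q) where
  ae_posDef := by
    rw [gramHaar, ae_withDensity_iff (measurable_pdWeight _)]
    exact Filter.Eventually.of_forall fun X hX => posDef_of_pdWeight_ne_zero hX
  lintegral_comp_conj {T} hT F hF := by
    have hc : Measurable fun X : Matrix (Fin q) (Fin q) ℂ => T * X * Tᴴ :=
      (by fun_prop : Continuous fun X : Matrix (Fin q) (Fin q) ℂ => T * X * Tᴴ).measurable
    have hF' : Measurable fun X => F (T * X * Tᴴ) := hF.comp hc
    have hG : Measurable fun X => pdWeight (Fintype.card m) X * F X :=
      (measurable_pdWeight _).mul hF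
    have hG' : Measurable fun C : Matrix m (Fin q) ℂ =>
        pdWeight (Fintype.card m) (Cᴴ * C) * F (Cᴴ * C) := hG.comp measurable_gram
    have hm : Measurable fun C : Matrix m (Fin q) ℂ =>
        pdWeight (Fintype.card m) (T * (Cᴴ * C) * Tᴴ) * F (T * (Cᴴ * C) * Tᴴ) :=
      (hG.comp hc).comp measurable_gram
    have hcg (C : Matrix m (Fin q) ℂ) : (C * Tᴴ)ᴴ * (C * Tᴴ) = T * (Cᴴ * C) * Tᴴ := by
      simp only [conjTranspose_mul, conjTranspose_conjTranspose, Matrix.mul_assoc]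
    rw [lintegral_gramHaar hF',
      lintegral_gramHaar hF, lintegral_mul_right (det_conjTranspose_ne_zero hT) hG']
    simp only [hcg]
    rw [← lintegral_const_mul _ hm, enorm_det_conjTranspose]
    simp only [← mul_assoc _ (pdWeight _ _), pdWeight_conj _ hT]

/-- A neighbourhood of the identity in the cone with bounded entries. -/
def refSet (q : ℕ) : Set (Matrix (Fin q) (Fin q) ℂ) := {X | ∀ i j, ‖X i j‖ < 2}

theorem isOpen_refSet (q : ℕ) : IsOpen (refSet q) := by
  simp only [refSet, Set.ofPred_forall]
  refine isOpen_iInter_of_finite fun i => isOpen_iInter_of_finite fun j => ?_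
  exact isOpen_lt ((continuous_id.matrix_elem i j).norm) continuous_const

theorem one_mem_refSet (q : ℕ) : (1 : Matrix (Fin q) (Fin q) ℂ) ∈ refSet q := by
  intro i j
  by_cases h : i = j <;> simp [one_apply, h]

theorem volume_bounded_lt_top {E : Type*} [NormedAddCommGroup E] [NormedSpace ℝ E]
    [FiniteDimensional ℝ E] [MeasureSpace E] [BorelSpace E]
    [(volume : Measure E).IsAddHaarMeasure] {m n : Type*} [Fintype m] [Fintype n] (R : ℝ) :
    volume {Z : m → n → E | ∀ i j, ‖Z i j‖ ≤ R} < ⊤ := by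
  refine (measure_mono (t := Metric.closedBall 0 (max R 0)) fun Z hZ => ?_).trans_lt
    (isCompact_closedBall _ _).measure_lt_top
  rw [mem_closedBall_zero_iff]
  refine (pi_norm_le_iff_of_nonneg (le_max_right _ _)).mpr fun i => ?_
  exact (pi_norm_le_iff_of_nonneg (le_max_right _ _)).mpr fun j => (hZ i j).trans (le_max_left _ _)

/-- A diagonal entry of the Gram matrix is the squared norm of a column of `C`, so each `‖C i j‖²`
is below `2`. -/
theorem norm_le_of_gram_mem_refSet {m : Type*} [Fintype m] {C : Matrix m (Fin q) ℂ}
    (hC : Cᴴ * C ∈ refSet q) (i : m) (j : Fin q) : ‖C i j‖ ≤ 2 := by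
  have h := hC j j
  have h1 : (Cᴴ * C) j j = ((∑ i, ‖C i j‖ ^ 2 : ℝ) : ℂ) := by
    simp only [mul_apply, conjTranspose_apply]
    push_cast
    exact Finset.sum_congr rfl fun i _ => RCLike.conj_mul _
  rw [h1, Complex.norm_real, Real.norm_of_nonneg (by positivity)] at h
  have h2 : ‖C i j‖ ^ 2 ≤ ∑ i, ‖C i j‖ ^ 2 :=
    Finset.single_le_sum (f := fun i => ‖C i j‖ ^ 2) (fun _ _ => by positivity) (Finset.mem_univ i)
  nlinarith [norm_nonneg (C i j)]

theorem volume_gram_refSet_lt_top (m : Type*) [Fintype m] :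
    volume {C : Matrix m (Fin q) ℂ | Cᴴ * C ∈ refSet q} < ⊤ :=
  (measure_mono fun _ hC i j => norm_le_of_gram_mem_refSet hC i j).trans_lt
    (volume_bounded_lt_top (E := ℂ) (m := m) (n := Fin q) 2)

/-- The test function `Δ(X)^q 1_{refSet}(X)` on the cone. -/
def refFun (X : Matrix (Fin q) (Fin q) ℂ) : ENNReal :=
  (posDefSet q ∩ refSet q).indicator (fun X => ‖X.det‖ₑ ^ q) X

theorem measurable_refFun : Measurable (refFun (q := q)) :=
  (measurable_enorm_det.pow_const q).indicator
    ((measurableSet_posDefSet q).inter (isOpen_refSet q).measurableSet)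

/-- The factor `Δ^q` in `refFun` cancels the Haar density, leaving the Lebesgue volume of a bounded
nonempty open set, which is finite and nonzero. -/
theorem lintegral_refFun_glHaar :
    ∫⁻ T, refFun (T * Tᴴ) ∂(glHaar q) =
      volume {T : Matrix (Fin q) (Fin q) ℂ | T.det ≠ 0 ∧ T * Tᴴ ∈ refSet q} := by
  have hsq : Continuous fun T : Matrix (Fin q) (Fin q) ℂ => T * Tᴴ := by fun_prop
  have hms : MeasurableSet {T : Matrix (Fin q) (Fin q) ℂ | T.det ≠ 0 ∧ T * Tᴴ ∈ refSet q} :=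
    (measurableSet_det_ne_zero q).inter ((isOpen_refSet q).preimage hsq).measurableSet
  have hm : Measurable fun T : Matrix (Fin q) (Fin q) ℂ => refFun (T * Tᴴ) :=
    measurable_refFun.comp hsq.measurable
  rw [lintegral_glHaar hm, ← lintegral_indicator_one hms]
  refine lintegral_congr fun T => ?_
  by_cases hT : T.det = 0
  · rw [Set.indicator_of_notMem (fun h => h.1 hT)]
    simp [glWeight, Set.indicator, hT]
  have hpd : (T * Tᴴ).PosDef := by
    have := (posDef_mul_mul_conjTranspose_iff hT).mpr (PosDef.one (n := Fin q) (R := ℂ))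
    rwa [Matrix.mul_one] at this
  by_cases hK : T * Tᴴ ∈ refSet q
  · rw [Set.indicator_of_mem (show T ∈ {T | T.det ≠ 0 ∧ T * Tᴴ ∈ refSet q} from ⟨hT, hK⟩), glWeight,
      Set.indicator_of_mem (show T ∈ {T | T.det ≠ 0} from hT), refFun,
      Set.indicator_of_mem (show T * Tᴴ ∈ posDefSet q ∩ refSet q from ⟨hpd, hK⟩)]
    have h := enorm_det_conj T 1
    rw [Matrix.mul_one, det_one, enorm_one, mul_one] at h
    have hT' : ‖T.det‖ₑ ≠ 0 := by simpa using hT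
    rw [h, ← pow_mul, ← mul_pow, ENNReal.inv_mul_cancel hT' enorm_ne_top, one_pow, Pi.one_apply]
  · rw [Set.indicator_of_notMem (fun h => hK h.2), refFun,
      Set.indicator_of_notMem (fun h => hK h.2), mul_zero]

theorem lintegral_refFun_glHaar_ne_zero : ∫⁻ T, refFun (T * Tᴴ) ∂(glHaar q) ≠ 0 := by
  have hsq : Continuous fun T : Matrix (Fin q) (Fin q) ℂ => T * Tᴴ := by fun_prop
  rw [lintegral_refFun_glHaar]
  refine (IsOpen.measure_pos _ ?_ ⟨1, ?_⟩).ne'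
  · exact (isOpen_ne_fun continuous_id.matrix_det continuous_const).inter
      ((isOpen_refSet q).preimage hsq)
  · exact ⟨by simp, by simpa using one_mem_refSet q⟩

theorem lintegral_refFun_glHaar_ne_top : ∫⁻ T, refFun (T * Tᴴ) ∂(glHaar q) ≠ ⊤ := by
  rw [lintegral_refFun_glHaar]
  have h (T : Matrix (Fin q) (Fin q) ℂ) (hT : T * Tᴴ ∈ refSet q) (i j : Fin q) : ‖T i j‖ ≤ 2 := by
    have h1 : (Tᴴ)ᴴ * Tᴴ ∈ refSet q := by rwa [conjTranspose_conjTranspose]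
    have h2 := norm_le_of_gram_mem_refSet h1 j i
    rwa [conjTranspose_apply, norm_star] at h2
  exact ((measure_mono fun T hT i j => h T hT.2 i j).trans_lt
    (volume_bounded_lt_top (E := ℂ) (m := Fin q) (n := Fin q) 2)).ne

/-- Here too `Δ^q` cancels the density. The remaining set is bounded and contains a neighbourhood of
the coordinates of the identity. -/
theorem lintegral_refFun_coneHaar :
    ∫⁻ X, refFun X ∂(coneHaar q) =
      volume {S : Fin q → Fin q → ℝ | hermLin q S ∈ posDefSet q ∩ refSet q} := by
  have hms : MeasurableSet (posDefSet q ∩ refSet q) :=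
    (measurableSet_posDefSet q).inter (isOpen_refSet q).measurableSet
  have hms' : MeasurableSet {S : Fin q → Fin q → ℝ | hermLin q S ∈ posDefSet q ∩ refSet q} :=
    measurable_hermLin hms
  have hm : Measurable fun X : Matrix (Fin q) (Fin q) ℂ => pdWeight q X * refFun X :=
    (measurable_pdWeight q).mul measurable_refFun
  rw [lintegral_coneHaar measurable_refFun, lintegral_hermVolume hm,
    ← lintegral_indicator_one hms']
  refine lintegral_congr fun S => ?_
  by_cases hS : hermLin q S ∈ posDefSet q ∩ refSet q
  · rw [Set.indicator_of_mem (show S ∈ {S | hermLin q S ∈ posDefSet q ∩ refSet q} from hS),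
      refFun, Set.indicator_of_mem hS, pdWeight, pdInd_of_posDef hS.1, one_mul, ← mul_pow,
      ENNReal.inv_mul_cancel (enorm_det_ne_zero hS.1) enorm_ne_top, one_pow, Pi.one_apply]
  · rw [Set.indicator_of_notMem (show S ∉ {S | hermLin q S ∈ posDefSet q ∩ refSet q} from hS),
      refFun, Set.indicator_of_notMem hS, mul_zero]

theorem lintegral_refFun_coneHaar_ne_zero : ∫⁻ X, refFun X ∂(coneHaar q) ≠ 0 := by
  rw [lintegral_refFun_coneHaar]
  refine (Measure.measure_pos_of_mem_nhds (x := hermCoord q 1) volume ?_).ne'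
  have h : Filter.Tendsto (hermLin q) (nhds (hermCoord q 1)) (nhds 1) :=
    (continuous_hermLin (q := q)).tendsto' _ _ (hermLin_hermCoord isHermitian_one)
  filter_upwards [h.eventually (eventually_posDef_one q),
    h.eventually ((isOpen_refSet q).mem_nhds (one_mem_refSet q))] with S h1 h2
  exact ⟨h1 (isHermitian_hermLin S), h2⟩

theorem lintegral_refFun_coneHaar_ne_top : ∫⁻ X, refFun X ∂(coneHaar q) ≠ ⊤ := by
  rw [lintegral_refFun_coneHaar]
  refine ((measure_mono fun S hS i j => ?_).trans_lt
    (volume_bounded_lt_top (E := ℝ) (m := Fin q) (n := Fin q) 4)).ne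
  have h := hS.2 i j
  have h1 : S i j = (hermLin q S i j).re + (hermLin q S i j).im :=
    (congrFun (congrFun (hermCoord_hermLin S) i) j).symm
  rw [h1, Real.norm_eq_abs]
  calc _ ≤ |(hermLin q S i j).re| + |(hermLin q S i j).im| := abs_add_le _ _
    _ ≤ 2 + 2 := add_le_add ((Complex.abs_re_le_norm _).trans h.le)
      ((Complex.abs_im_le_norm _).trans h.le)
    _ = 4 := by norm_num

theorem exists_lintegral_gramHaar_eq (m : Type*) [Fintype m] [DecidableEq m] (q : ℕ) :
    ∃ c : ENNReal, ∀ F : Matrix (Fin q) (Fin q) ℂ → ENNReal, Measurable F →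
      ∫⁻ X, F X ∂(gramHaar m q) = c * ∫⁻ X, F X ∂(coneHaar q) :=
  ⟨_, fun _ hF => (isConeInvariant_gramHaar m q).lintegral_eq_const_mul
    (isConeInvariant_coneHaar q) measurable_refFun lintegral_refFun_glHaar_ne_zero
    lintegral_refFun_glHaar_ne_top lintegral_refFun_coneHaar_ne_zero
    lintegral_refFun_coneHaar_ne_top hF⟩

end Cone

/-! ### Almost every rectangular matrix has full rank -/

section FullRank

theorem lintegral_volume_add_right {m n : Type*} [Fintype m] [Fintype n] (Z₀ : Matrix m n ℂ)
    (F : Matrix m n ℂ → ENNReal) : ∫⁻ Z : Matrix m n ℂ, F (Z + Z₀) = ∫⁻ Z, F Z :=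
  lintegral_add_right_eq_self (μ := (volume : Measure (m → n → ℂ))) F Z₀

variable {n q : ℕ}

/-- The zeros are real roots of the characteristic polynomial of `-M`, hence finite in number. -/
theorem volume_det_add_smul_one_eq_zero (M : Matrix (Fin q) (Fin q) ℂ) :
    volume {t : ℝ | (M + (t : ℂ) • (1 : Matrix (Fin q) (Fin q) ℂ)).det = 0} = 0 := by
  have h : {t : ℝ | (M + (t : ℂ) • (1 : Matrix (Fin q) (Fin q) ℂ)).det = 0} =
      (fun t : ℝ => (t : ℂ)) ⁻¹' {z | (-M).charpoly.IsRoot z} := by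
    ext t
    simp only [Set.mem_ofPred_eq, Set.mem_preimage, Polynomial.IsRoot, eval_charpoly]
    rw [sub_neg_eq_add, add_comm, scalar_apply, ← smul_one_eq_diagonal]
  rw [h]
  refine Set.Finite.measure_zero (Set.Finite.preimage Complex.ofReal_injective.injOn ?_) _
  exact Polynomial.finite_setOfPred_isRoot (charpoly_monic _).ne_zero

/-- Let `N` be the exceptional set and `E` a matrix whose selected block is the identity. Each line
`C + t E` meets `N` for finitely many real `t`. By translation invariance, the volume of `N` is the
average over `t ∈ [0, 1]` of the volumes of its translates, and Tonelli makes this average zero. -/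
theorem ae_det_submatrix_ne_zero {e : Fin q → Fin n} (he : Function.Injective e) :
    ∀ᵐ C : Matrix (Fin n) (Fin q) ℂ, (C.submatrix e id).det ≠ 0 := by
  let E : Matrix (Fin n) (Fin q) ℂ := Matrix.of fun i j => if i = e j then 1 else 0
  have hE : E.submatrix e id = 1 := by
    ext i j
    simp [E, one_apply, he.eq_iff]
  let N : Set (Matrix (Fin n) (Fin q) ℂ) := {C | (C.submatrix e id).det = 0}
  have hNc : IsClosed N :=
    isClosed_eq (Continuous.matrix_det (continuous_id.matrix_submatrix e id)) continuous_const
  have hind : Measurable (N.indicator (1 : Matrix (Fin n) (Fin q) ℂ → ENNReal)) :=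
    measurable_one.indicator hNc.measurableSet
  have hm : Measurable fun p : ℝ × Matrix (Fin n) (Fin q) ℂ => p.2 + (p.1 : ℂ) • E :=
    (by fun_prop : Continuous fun p : ℝ × Matrix (Fin n) (Fin q) ℂ =>
      p.2 + (p.1 : ℂ) • E).measurable
  have hswap := lintegral_lintegral_swap (μ := volume.restrict (Set.Icc (0 : ℝ) 1))
    (ν := (volume : Measure (Matrix (Fin n) (Fin q) ℂ)))
    (f := fun t C => N.indicator 1 (C + (t : ℂ) • E)) (hind.comp hm).aemeasurable
  have hleft : ∫⁻ t : ℝ in Set.Icc (0 : ℝ) 1, ∫⁻ C, N.indicator 1 (C + (t : ℂ) • E) =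
      volume N := by
    simp only [lintegral_volume_add_right _ (N.indicator 1), lintegral_indicator_one
      hNc.measurableSet]
    simp
  have hright : ∫⁻ C, ∫⁻ t : ℝ in Set.Icc (0 : ℝ) 1, N.indicator 1 (C + (t : ℂ) • E) = 0 := by
    rw [lintegral_eq_zero_iff']
    · refine Filter.Eventually.of_forall fun C => ?_
      have h0 : ∀ᵐ t : ℝ, N.indicator (1 : Matrix (Fin n) (Fin q) ℂ → ENNReal) (C + (t : ℂ) • E) = 0 := by
        rw [ae_iff]
        refine measure_mono_null (fun t ht => ?_)
          (volume_det_add_smul_one_eq_zero (C.submatrix e id))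
        have htN : C + (t : ℂ) • E ∈ N := by
          by_contra h
          exact ht (Set.indicator_of_notMem h _)
        have htN' : ((C + (t : ℂ) • E).submatrix e id).det = 0 := htN
        rw [submatrix_add, submatrix_smul, Pi.add_apply, Pi.add_apply, Pi.smul_apply,
          Pi.smul_apply, hE] at htN'
        exact htN'
      exact (lintegral_congr_ae (ae_restrict_of_ae h0)).trans lintegral_zero
    · exact ((hind.comp hm).lintegral_prod_left').aemeasurable
  rw [ae_iff]
  simp only [not_not]
  exact hleft.symm.trans (hswap.trans hright)

theorem posDef_gram_of_det_submatrix_ne_zero {e : Fin q → Fin n} {C : Matrix (Fin n) (Fin q) ℂ}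
    (hC : (C.submatrix e id).det ≠ 0) : (Cᴴ * C).PosDef := by
  refine PosDef.conjTranspose_mul_self C fun v w hvw => ?_
  have h (u : Fin q → ℂ) : C.submatrix e id *ᵥ u = (C *ᵥ u) ∘ e := rfl
  have h1 : C.submatrix e id *ᵥ v = C.submatrix e id *ᵥ w := by
    rw [h, h, show C *ᵥ v = C *ᵥ w from hvw]
  exact mulVec_injective_of_isUnit ((isUnit_iff_isUnit_det _).mpr hC.isUnit) h1

theorem ae_posDef_gram (h : q ≤ n) :
    ∀ᵐ C : Matrix (Fin n) (Fin q) ℂ, (Cᴴ * C).PosDef := by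
  filter_upwards [ae_det_submatrix_ne_zero (Fin.castLE_injective h)] with C hC
  exact posDef_gram_of_det_submatrix_ne_zero hC

end FullRank

/-! ### The distribution of a block of a normalized rectangular matrix -/

section Block

variable {n q : ℕ}

/-- Uniqueness of the invariant measure is applied to `Δ^n H`: the weight `Δ^(-n)` of `gramHaar`
cancels, while `Δ^(-q)` of `coneHaar` leaves `Δ^(n - q)`. The hypothesis `q ≤ n` makes almost every
Gram matrix positive definite. -/
theorem exists_lintegral_gram_eq (h : q ≤ n) :
    ∃ c : ENNReal, ∀ H : Matrix (Fin q) (Fin q) ℂ → ENNReal, Measurable H →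
      ∫⁻ C : Matrix (Fin n) (Fin q) ℂ, H (Cᴴ * C) =
        c * ∫⁻ X, pdInd X * (‖X.det‖ₑ ^ (n - q) * H X) ∂(hermVolume q) := by
  obtain ⟨c, hc⟩ := exists_lintegral_gramHaar_eq (Fin n) q
  refine ⟨c, fun H hH => ?_⟩
  have hm : Measurable fun X : Matrix (Fin q) (Fin q) ℂ => ‖X.det‖ₑ ^ n * H X :=
    (measurable_enorm_det.pow_const n).mul hH
  have key := hc _ hm
  rw [lintegral_gramHaar hm, lintegral_coneHaar hm, Fintype.card_fin] at key
  rw [lintegral_congr_ae (g := fun C => pdWeight n (Cᴴ * C) * (‖(Cᴴ * C).det‖ₑ ^ n * H (Cᴴ * C))),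
    key]
  · congr 1
    refine lintegral_congr fun X => ?_
    by_cases hX : X.PosDef
    · have h0 := enorm_det_ne_zero hX
      rw [pdWeight, pdInd_of_posDef hX, one_mul, one_mul, ← mul_assoc]
      congr 1
      conv_lhs => rw [← Nat.add_sub_cancel' h, pow_add, ← mul_assoc, ← mul_pow,
        ENNReal.inv_mul_cancel h0 enorm_ne_top, one_pow, one_mul]
    · rw [pdWeight, pdInd_of_not_posDef hX, zero_mul, zero_mul, zero_mul]
  · filter_upwards [ae_posDef_gram h] with C hC
    rw [pdWeight, pdInd_of_posDef hC, one_mul, ← mul_assoc, ← mul_pow,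
      ENNReal.inv_mul_cancel (enorm_det_ne_zero hC) enorm_ne_top, one_pow, one_mul]

/-- The density `Δ(I - wᴴ w)^k` on the matrix ball. -/
def ballWeight (k : ℕ) (w : Matrix (Fin q) (Fin q) ℂ) : ENNReal :=
  pdInd (1 - wᴴ * w) * ‖(1 - wᴴ * w).det‖ₑ ^ k

theorem measurable_ballWeight (k : ℕ) : Measurable (ballWeight (q := q) k) := by
  have h : Measurable fun w : Matrix (Fin q) (Fin q) ℂ => 1 - wᴴ * w :=
    (by fun_prop : Continuous fun w : Matrix (Fin q) (Fin q) ℂ => 1 - wᴴ * w).measurable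
  exact (measurable_pdInd.comp h).mul ((measurable_enorm_det.comp h).pow_const k)

/-- Substitute `A = w √Y`. Then `Y - Aᴴ A = √Y (1 - wᴴ w) √Y`, and the Jacobian `Δ(Y)^q` raises
`Δ(Y)^(n - q)` to `Δ(Y)^n`. -/
theorem lintegral_fiber (h : q ≤ n) {F : Matrix (Fin q) (Fin q) ℂ → ENNReal} (hF : Measurable F)
    (Y : Matrix (Fin q) (Fin q) ℂ) :
    ∫⁻ A : Matrix (Fin q) (Fin q) ℂ, pdInd (-(Aᴴ * A) + Y) * ‖(-(Aᴴ * A) + Y).det‖ₑ ^ (n - q) *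
      F (A * (CFC.sqrt Y)⁻¹) =
      pdInd Y * ‖Y.det‖ₑ ^ n * ∫⁻ w, ballWeight (n - q) w * F w := by
  by_cases hY : Y.PosDef
  · have hS := det_sqrt_ne_zero hY
    have hc : Measurable fun A : Matrix (Fin q) (Fin q) ℂ => -(Aᴴ * A) + Y :=
      (by fun_prop : Continuous fun A : Matrix (Fin q) (Fin q) ℂ => -(Aᴴ * A) + Y).measurable
    have hc' : Measurable fun A : Matrix (Fin q) (Fin q) ℂ => A * (CFC.sqrt Y)⁻¹ :=
      (by fun_prop : Continuous fun A : Matrix (Fin q) (Fin q) ℂ =>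
        A * (CFC.sqrt Y)⁻¹).measurable
    have hG : Measurable fun A : Matrix (Fin q) (Fin q) ℂ =>
        pdInd (-(Aᴴ * A) + Y) * ‖(-(Aᴴ * A) + Y).det‖ₑ ^ (n - q) * F (A * (CFC.sqrt Y)⁻¹) :=
      ((measurable_pdInd.comp hc).mul ((measurable_enorm_det.comp hc).pow_const _)).mul
        (hF.comp hc')
    have hconj (w : Matrix (Fin q) (Fin q) ℂ) :
        -((w * CFC.sqrt Y)ᴴ * (w * CFC.sqrt Y)) + Y =
          CFC.sqrt Y * (1 - wᴴ * w) * (CFC.sqrt Y)ᴴ := by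
      rw [conjTranspose_mul, conjTranspose_sqrt, Matrix.mul_sub, Matrix.sub_mul, Matrix.mul_one,
        sqrt_mul_sqrt hY.posSemidef, neg_add_eq_sub]
      simp only [Matrix.mul_assoc]
    rw [lintegral_mul_right hS hG, Fintype.card_fin, pdInd_of_posDef hY, one_mul]
    have hdet : ‖Y.det‖ₑ = ‖(CFC.sqrt Y).det‖ₑ ^ 2 := by
      rw [← det_sqrt_mul_det_sqrt hY.posSemidef, enorm_mul, sq]
    have hbF : Measurable fun w => ballWeight (n - q) w * F w := (measurable_ballWeight _).mul hF
    rw [← lintegral_const_mul _ hbF, ← lintegral_const_mul]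
    · refine lintegral_congr fun w => ?_
      rw [hconj, pdInd_conj hS, enorm_det_conj, mul_nonsing_inv_cancel_right _ _ hS.isUnit,
        hdet, ballWeight, mul_pow]
      conv_rhs => rw [← Nat.add_sub_cancel' h, pow_add, ← pow_mul]
      simp only [Nat.add_sub_cancel_left]
      ring
    · exact hG.comp (by fun_prop : Continuous fun A : Matrix (Fin q) (Fin q) ℂ =>
        A * CFC.sqrt Y).measurable
  · rw [pdInd_of_not_posDef hY, zero_mul, zero_mul]
    refine (lintegral_congr fun A => ?_).trans lintegral_zero
    rw [pdInd_of_not_posDef, zero_mul, zero_mul]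
    -- If `Y - Aᴴ A` is positive definite, so is `Y`; for other `Y` both sides vanish.
    intro hA
    apply hY
    have := hA.add_posSemidef (posSemidef_conjTranspose_mul_self A)
    rwa [neg_add_eq_sub, sub_add_cancel] at this

/-- Translating the Gram variable to `Y = Aᴴ A + X` and integrating over `A` first separates `w`
from `Y`. The constant absorbs the `Y`-integral, so it depends on `g` but not on `F`. -/
theorem exists_lintegral_block_eq (h : q ≤ n) {g : Matrix (Fin q) (Fin q) ℂ → ENNReal}
    (hg : Measurable g) :
    ∃ c : ENNReal, ∀ F : Matrix (Fin q) (Fin q) ℂ → ENNReal, Measurable F →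
      ∫⁻ A : Matrix (Fin q) (Fin q) ℂ, ∫⁻ C : Matrix (Fin n) (Fin q) ℂ,
        F (A * (CFC.sqrt (Aᴴ * A + Cᴴ * C))⁻¹) * g (Aᴴ * A + Cᴴ * C) =
      c * ∫⁻ w, ballWeight (n - q) w * F w := by
  obtain ⟨c, hc⟩ := exists_lintegral_gram_eq h
  refine ⟨c * ∫⁻ Y, pdInd Y * ‖Y.det‖ₑ ^ n * g Y ∂(hermVolume q), fun F hF => ?_⟩
  have hsub : Measurable fun p : Matrix (Fin q) (Fin q) ℂ × Matrix (Fin q) (Fin q) ℂ =>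
      -(p.1ᴴ * p.1) + p.2 :=
    (by fun_prop : Continuous fun p : Matrix (Fin q) (Fin q) ℂ × Matrix (Fin q) (Fin q) ℂ =>
      -(p.1ᴴ * p.1) + p.2).measurable
  have hmul : Measurable fun p : Matrix (Fin q) (Fin q) ℂ × Matrix (Fin q) (Fin q) ℂ =>
      p.1 * p.2 :=
    (by fun_prop : Continuous fun p : Matrix (Fin q) (Fin q) ℂ × Matrix (Fin q) (Fin q) ℂ =>
      p.1 * p.2).measurable
  have hdiv : Measurable fun p : Matrix (Fin q) (Fin q) ℂ × Matrix (Fin q) (Fin q) ℂ =>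
      p.1 * (CFC.sqrt p.2)⁻¹ := by
    have h1 : Measurable fun p : Matrix (Fin q) (Fin q) ℂ × Matrix (Fin q) (Fin q) ℂ =>
        (p.1, (CFC.sqrt p.2)⁻¹) :=
      measurable_fst.prodMk (measurable_inv_matrix.comp (measurable_sqrt.comp measurable_snd))
    exact Measurable.comp (f := fun p : Matrix (Fin q) (Fin q) ℂ × Matrix (Fin q) (Fin q) ℂ =>
      (p.1, (CFC.sqrt p.2)⁻¹)) hmul h1
  let K (A Y : Matrix (Fin q) (Fin q) ℂ) : ENNReal :=
    pdInd (-(Aᴴ * A) + Y) * ‖(-(Aᴴ * A) + Y).det‖ₑ ^ (n - q) * F (A * (CFC.sqrt Y)⁻¹)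
  have hK : Measurable fun p : Matrix (Fin q) (Fin q) ℂ × Matrix (Fin q) (Fin q) ℂ =>
      K p.1 p.2 :=
    ((measurable_pdInd.comp hsub).mul ((measurable_enorm_det.comp hsub).pow_const _)).mul
      (hF.comp hdiv)
  have hKg : Measurable fun p : Matrix (Fin q) (Fin q) ℂ × Matrix (Fin q) (Fin q) ℂ =>
      K p.1 p.2 * g p.2 := hK.mul (hg.comp measurable_snd)
  have hinner (A : Matrix (Fin q) (Fin q) ℂ) :
      ∫⁻ C : Matrix (Fin n) (Fin q) ℂ,
        F (A * (CFC.sqrt (Aᴴ * A + Cᴴ * C))⁻¹) * g (Aᴴ * A + Cᴴ * C) =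
      c * ∫⁻ Y, K A Y * g Y ∂(hermVolume q) := by
    have hadd : Measurable fun X : Matrix (Fin q) (Fin q) ℂ => Aᴴ * A + X :=
      (by fun_prop : Continuous fun X : Matrix (Fin q) (Fin q) ℂ => Aᴴ * A + X).measurable
    have hFA : Measurable fun X : Matrix (Fin q) (Fin q) ℂ => F (A * (CFC.sqrt X)⁻¹) * g X := by
      have := (hF.comp (hdiv.comp (measurable_prodMk_left (x := A)))).mul hg
      exact this
    have hH : Measurable fun X : Matrix (Fin q) (Fin q) ℂ =>
        F (A * (CFC.sqrt (Aᴴ * A + X))⁻¹) * g (Aᴴ * A + X) := hFA.comp hadd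
    rw [hc _ hH]
    congr 1
    have hG : Measurable fun X : Matrix (Fin q) (Fin q) ℂ => pdInd X * (‖X.det‖ₑ ^ (n - q) *
        (F (A * (CFC.sqrt (Aᴴ * A + X))⁻¹) * g (Aᴴ * A + X))) :=
      measurable_pdInd.mul ((measurable_enorm_det.pow_const _).mul hH)
    rw [← lintegral_hermVolume_add (isHermitian_conjTranspose_mul_self A).neg hG]
    refine lintegral_congr fun Y => ?_
    rw [add_neg_cancel_left]
    simp only [K, mul_assoc]
  have hfib (Y : Matrix (Fin q) (Fin q) ℂ) :
      ∫⁻ A, K A Y * g Y =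
        pdInd Y * ‖Y.det‖ₑ ^ n * g Y * ∫⁻ w, ballWeight (n - q) w * F w := by
    have hKY : Measurable fun A => K A Y := by
      have := hK.comp (measurable_prodMk_right (y := Y))
      exact this
    rw [lintegral_mul_const _ hKY, lintegral_fiber h hF]
    ring
  simp only [hinner]
  have hψ : Measurable fun Y => pdInd Y * ‖Y.det‖ₑ ^ n * g Y :=
    (measurable_pdInd.mul (measurable_enorm_det.pow_const n)).mul hg
  rw [lintegral_const_mul _ (hKg.lintegral_prod_right' (ν := hermVolume q) :),
    lintegral_lintegral_swap (f := fun A Y => K A Y * g Y) hKg.aemeasurable, mul_assoc,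
    ← lintegral_mul_const _ hψ]
  congr 1
  exact lintegral_congr hfib

end Block

/-! ### Haar measure on the unitary group -/

section UnitaryHaar

variable {p : ℕ}

instance : CompactSpace (U p) := by
  refine isCompact_iff_compactSpace.mp ?_
  have hb : IsCompact {Z : Matrix (Fin p) (Fin p) ℂ | ∀ i j, Z i j ∈ Metric.closedBall (0 : ℂ) 1} :=
    IsCompact.matrix (isCompact_closedBall 0 1)
  refine hb.of_isClosed_subset ?_ fun u hu i j => ?_
  · have h : ((unitaryGroup (Fin p) ℂ : Set (Matrix (Fin p) (Fin p) ℂ))) = {u | star u * u = 1} := by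
      ext u
      exact mem_unitaryGroup_iff'
    change IsClosed (unitaryGroup (Fin p) ℂ : Set (Matrix (Fin p) (Fin p) ℂ))
    rw [h]
    exact isClosed_eq (by fun_prop) continuous_const
  · rw [mem_closedBall_zero_iff]
    exact entry_norm_bound_of_unitary hu i j

/-- The normalized Haar measure of `U_p`. -/
def unitaryHaar (p : ℕ) : Measure (U p) := Measure.haarMeasure ⊤

instance : (unitaryHaar p).IsHaarMeasure := by unfold unitaryHaar; infer_instance

instance : IsProbabilityMeasure (unitaryHaar p) := ⟨Measure.haarMeasure_self⟩

instance : (unitaryHaar p).IsMulRightInvariant where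
  map_mul_right_eq_self g := by
    -- A right translate is again a left Haar probability measure, and there is only one.
    have : IsProbabilityMeasure ((unitaryHaar p).map (· * g)) :=
      Measure.isProbabilityMeasure_map (measurable_mul_const g).aemeasurable
    exact Measure.isHaarMeasure_eq_of_isProbabilityMeasure _ _

end UnitaryHaar

/-! ### Polar decomposition -/

section Polar

variable {p q : ℕ}

theorem norm_sq_toLp_mulVec {m n : Type*} [Fintype m] [Fintype n] (x : Matrix m n ℂ) (v : n → ℂ) :
    (‖WithLp.toLp 2 (x *ᵥ v)‖ ^ 2 : ℝ) = (star v ⬝ᵥ ((xᴴ * x) *ᵥ v)).re := by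
  rw [← inner_self_eq_norm_sq (𝕜 := ℂ), EuclideanSpace.inner_toLp_toLp, ← mulVec_mulVec,
    dotProduct_mulVec (star v), dotProduct_comm, ← star_mulVec]
  rfl

/-- Equal Gram matrices give `‖x v‖ = ‖y v‖`, so `x v ↦ y v` is a well-defined isometry on the range
of `x`. It extends to a linear isometry of `ℂ^p`, that is, to a unitary matrix. -/
theorem exists_unitary_mul_eq {x y : Matrix (Fin p) (Fin q) ℂ} (h : xᴴ * x = yᴴ * y) :
    ∃ u : U p, (u : Matrix (Fin p) (Fin p) ℂ) * x = y := by
  let X := toEuclideanLin x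
  let Y := toEuclideanLin y
  have hnorm (v : EuclideanSpace ℂ (Fin q)) : ‖X v‖ = ‖Y v‖ := by
    rw [← sq_eq_sq₀ (norm_nonneg _) (norm_nonneg _)]
    change ‖WithLp.toLp 2 (x *ᵥ v.ofLp)‖ ^ 2 = ‖WithLp.toLp 2 (y *ᵥ v.ofLp)‖ ^ 2
    rw [norm_sq_toLp_mulVec, norm_sq_toLp_mulVec, h]
  -- `s` chooses preimages linearly; the choice is immaterial because `X` and `Y` have the same
  -- kernel.
  obtain ⟨s, hs⟩ := LinearMap.exists_rightInverse_of_surjective X.rangeRestrict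
    X.range_rangeRestrict
  have hXs (z : X.range) : X (s z) = z := congrArg Subtype.val (LinearMap.congr_fun hs z)
  let L : X.range →ₗᵢ[ℂ] EuclideanSpace ℂ (Fin p) :=
    { toLinearMap := Y ∘ₗ s
      norm_map' := fun z => by
        change ‖Y (s z)‖ = ‖(z : EuclideanSpace ℂ (Fin p))‖
        rw [← hnorm, hXs] }
  have hL (v : EuclideanSpace ℂ (Fin q)) : L.extend (X v) = Y v := by
    have h1 := L.extend_apply ⟨X v, LinearMap.mem_range_self X v⟩
    refine h1.trans ?_
    change Y (s ⟨X v, LinearMap.mem_range_self X v⟩) = Y v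
    rw [← sub_eq_zero, ← map_sub, ← norm_eq_zero, ← hnorm, map_sub, hXs, sub_self, norm_zero]
  let u : Matrix (Fin p) (Fin p) ℂ := toEuclideanLin.symm L.extend.toLinearMap
  have hu (v : EuclideanSpace ℂ (Fin p)) : L.extend v = WithLp.toLp 2 (u *ᵥ v.ofLp) := by
    have : toEuclideanLin u = L.extend.toLinearMap := LinearEquiv.apply_symm_apply _ _
    exact (LinearMap.congr_fun this v).symm
  refine ⟨⟨u, mem_unitaryGroup_iff'.mpr ?_⟩, ?_⟩
  · ext i j
    have h1 := L.extend.inner_map_map (EuclideanSpace.single i 1) (EuclideanSpace.single j 1)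
    rw [hu, hu, EuclideanSpace.inner_toLp_toLp, EuclideanSpace.inner_single_left] at h1
    have hcol (j : Fin p) : u *ᵥ (EuclideanSpace.single j (1 : ℂ)).ofLp = u.col j := by
      simp
    rw [hcol, hcol] at h1
    simp only [star_eq_conjTranspose, mul_apply, conjTranspose_apply, one_apply]
    simp only [dotProduct, col_apply, Pi.star_apply, map_one, one_mul] at h1
    rw [Finset.sum_congr rfl fun k _ => mul_comm (star (u k i)) (u k j), h1]
    simp
  · ext i j
    have h1 := hL (EuclideanSpace.single j 1)
    rw [hu] at h1
    have h2 := congrFun (congrArg WithLp.ofLp h1) i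
    simpa [X, Y, toLpLin_apply, mul_apply, mulVec, dotProduct] using h2

/-- The isometric embedding `ℂ^q → ℂ^p` as a `p × q` matrix. -/
def embMat (p q : ℕ) : Matrix (Fin p) (Fin q) ℂ := Matrix.of fun i j => if (i : ℕ) = j then 1 else 0

theorem conjTranspose_embMat_mul (h : q ≤ p) (Z : Matrix (Fin p) (Fin q) ℂ) :
    (embMat p q)ᴴ * Z = Z.submatrix (Fin.castLE h) id := by
  ext i j
  simp only [mul_apply, conjTranspose_apply, embMat, of_apply, submatrix_apply, id]
  rw [Finset.sum_eq_single (Fin.castLE h i)]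
  · simp
  · intro k _ hk
    have : (k : ℕ) ≠ i := fun hki => hk (Fin.ext hki)
    simp [this]
  · simp

theorem conjTranspose_embMat_mul_embMat (h : q ≤ p) : (embMat p q)ᴴ * embMat p q = 1 := by
  rw [conjTranspose_embMat_mul h]
  ext i j
  simp [embMat, one_apply, Fin.ext_iff]

theorem exists_unitary_mul_embMat_mul_sqrt (h : q ≤ p) (Z : Matrix (Fin p) (Fin q) ℂ) :
    ∃ u : U p, (u : Matrix (Fin p) (Fin p) ℂ) * (embMat p q * CFC.sqrt (Zᴴ * Z)) = Z := by
  refine exists_unitary_mul_eq ?_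
  rw [conjTranspose_mul, Matrix.mul_assoc, ← Matrix.mul_assoc _ (embMat p q),
    conjTranspose_embMat_mul_embMat h, Matrix.one_mul, conjTranspose_sqrt,
    sqrt_mul_sqrt (posSemidef_conjTranspose_mul_self Z)]

end Polar

/-! ### The distribution of a block of a Haar unitary -/

section HaarBlock

variable {p q : ℕ}

theorem enorm_det_unitary (u : U p) : ‖(u : Matrix (Fin p) (Fin p) ℂ).det‖ₑ = 1 := by
  have h : ‖(u : Matrix (Fin p) (Fin p) ℂ).det‖ = 1 :=
    CStarRing.norm_of_mem_unitary (det_of_mem_unitary u.2)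
  rw [← ofReal_norm, h, ENNReal.ofReal_one]

theorem lintegral_unitary_mul (u : U p) {F : Matrix (Fin p) (Fin q) ℂ → ENNReal}
    (hF : Measurable F) :
    ∫⁻ Z : Matrix (Fin p) (Fin q) ℂ, F ((u : Matrix (Fin p) (Fin p) ℂ) * Z) = ∫⁻ Z, F Z := by
  have hu : (u : Matrix (Fin p) (Fin p) ℂ).det ≠ 0 := by
    intro h
    have := enorm_det_unitary u
    simp [h] at this
  rw [lintegral_mul_left hu hF, enorm_det_unitary, one_pow, one_mul]

theorem conjTranspose_unitary_mul_mul (u : U p) (Z : Matrix (Fin p) (Fin q) ℂ) :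
    ((u : Matrix (Fin p) (Fin p) ℂ) * Z)ᴴ * ((u : Matrix (Fin p) (Fin p) ℂ) * Z) = Zᴴ * Z := by
  have hu : (u : Matrix (Fin p) (Fin p) ℂ)ᴴ * (u : Matrix (Fin p) (Fin p) ℂ) = 1 :=
    mem_unitaryGroup_iff'.mp u.2
  rw [conjTranspose_mul, Matrix.mul_assoc, ← Matrix.mul_assoc _ _ Z, hu, Matrix.one_mul]

/-- The upper left `q × q` block of a unitary matrix. -/
def block (q : ℕ) (u : U p) : Matrix (Fin q) (Fin q) ℂ :=
  (embMat p q)ᴴ * (u : Matrix (Fin p) (Fin p) ℂ) * embMat p q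

theorem continuous_block : Continuous (block (p := p) q) := by
  unfold block
  fun_prop

/-- The upper block of the normalization `Z (ZᴴZ)^{-1/2}`. -/
def normalizedBlock (Z : Matrix (Fin p) (Fin q) ℂ) : Matrix (Fin q) (Fin q) ℂ :=
  (embMat p q)ᴴ * Z * (CFC.sqrt (Zᴴ * Z))⁻¹

theorem measurable_normalizedBlock : Measurable (normalizedBlock (p := p) (q := q)) := by
  have hmul : Measurable fun r : Matrix (Fin p) (Fin q) ℂ × Matrix (Fin q) (Fin q) ℂ =>
      (embMat p q)ᴴ * r.1 * r.2 :=
    (by fun_prop : Continuous fun r : Matrix (Fin p) (Fin q) ℂ × Matrix (Fin q) (Fin q) ℂ =>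
      (embMat p q)ᴴ * r.1 * r.2).measurable
  have hinv : Measurable fun Z : Matrix (Fin p) (Fin q) ℂ => (Z, (CFC.sqrt (Zᴴ * Z))⁻¹) :=
    measurable_id.prodMk (measurable_inv_matrix.comp (measurable_sqrt.comp measurable_gram))
  exact Measurable.comp (f := fun Z : Matrix (Fin p) (Fin q) ℂ =>
    (Z, (CFC.sqrt (Zᴴ * Z))⁻¹)) hmul hinv

/-- `v` is the unitary factor of a polar decomposition of `Z`; multiplying by `u` leaves the Gram
matrix unchanged and only turns `v` into `u v`. -/
theorem normalizedBlock_unitary_mul (h : q ≤ p) {Z : Matrix (Fin p) (Fin q) ℂ}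
    (hZ : (Zᴴ * Z).PosDef) :
    ∃ v : U p, ∀ u : U p,
      normalizedBlock ((u : Matrix (Fin p) (Fin p) ℂ) * Z) = block q (u * v) := by
  obtain ⟨v, hv⟩ := exists_unitary_mul_embMat_mul_sqrt h Z
  refine ⟨v, fun u => ?_⟩
  have hS := det_sqrt_ne_zero hZ
  rw [normalizedBlock, conjTranspose_unitary_mul_mul]
  calc (embMat p q)ᴴ * ((u : Matrix (Fin p) (Fin p) ℂ) * Z) * (CFC.sqrt (Zᴴ * Z))⁻¹
      = (embMat p q)ᴴ * ((u : Matrix (Fin p) (Fin p) ℂ) * ((v : Matrix (Fin p) (Fin p) ℂ) *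
          (embMat p q * CFC.sqrt (Zᴴ * Z)))) * (CFC.sqrt (Zᴴ * Z))⁻¹ := by rw [hv]
    _ = block q (u * v) := by
        simp only [← Matrix.mul_assoc]
        rw [mul_nonsing_inv_cancel_right _ _ hS.isUnit, block]
        simp only [Submonoid.coe_mul, Matrix.mul_assoc]

/-- Lebesgue measure is invariant under `Z ↦ u Z`, so `u` may be averaged over Haar measure. For
fixed `Z` the normalized block becomes `block q (u * v)`, and right invariance removes `v`. -/
theorem lintegral_normalizedBlock (h : q ≤ p) {F g : Matrix (Fin q) (Fin q) ℂ → ENNReal}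
    (hF : Measurable F) (hg : Measurable g) :
    ∫⁻ Z : Matrix (Fin p) (Fin q) ℂ, F (normalizedBlock Z) * g (Zᴴ * Z) =
    (∫⁻ u, F (block q u) ∂(unitaryHaar p)) * ∫⁻ Z : Matrix (Fin p) (Fin q) ℂ, g (Zᴴ * Z) := by
  let Φ (Z : Matrix (Fin p) (Fin q) ℂ) : ENNReal := F (normalizedBlock Z) * g (Zᴴ * Z)
  have hgm : Measurable fun Z : Matrix (Fin p) (Fin q) ℂ => g (Zᴴ * Z) := hg.comp measurable_gram
  have hΦ : Measurable Φ := (hF.comp measurable_normalizedBlock).mul hgm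
  have hact : Measurable fun r : U p × Matrix (Fin p) (Fin q) ℂ =>
      (r.1 : Matrix (Fin p) (Fin p) ℂ) * r.2 :=
    (by fun_prop : Continuous fun r : U p × Matrix (Fin p) (Fin q) ℂ =>
      (r.1 : Matrix (Fin p) (Fin p) ℂ) * r.2).measurable
  have hFb : Measurable fun u : U p => F (block q u) := hF.comp continuous_block.measurable
  calc ∫⁻ Z, Φ Z = ∫⁻ u : U p, ∫⁻ Z : Matrix (Fin p) (Fin q) ℂ,
          Φ ((u : Matrix (Fin p) (Fin p) ℂ) * Z) ∂volume ∂(unitaryHaar p) := by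
        simp only [lintegral_unitary_mul _ hΦ, lintegral_const, measure_univ, mul_one]
    _ = ∫⁻ Z : Matrix (Fin p) (Fin q) ℂ, ∫⁻ u : U p,
          Φ ((u : Matrix (Fin p) (Fin p) ℂ) * Z) ∂(unitaryHaar p) ∂volume :=
        lintegral_lintegral_swap (hΦ.comp hact).aemeasurable
    _ = ∫⁻ Z : Matrix (Fin p) (Fin q) ℂ,
          (∫⁻ u, F (block q u) ∂(unitaryHaar p)) * g (Zᴴ * Z) := by
        refine lintegral_congr_ae ?_
        filter_upwards [ae_posDef_gram h] with Z hZ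
        obtain ⟨v, hv⟩ := normalizedBlock_unitary_mul h hZ
        have hpt (u : U p) : Φ ((u : Matrix (Fin p) (Fin p) ℂ) * Z) =
            F (block q (u * v)) * g (Zᴴ * Z) := by
          simp only [Φ]
          rw [conjTranspose_unitary_mul_mul, hv]
        simp only [hpt]
        have hFbv : Measurable fun u : U p => F (block q (u * v)) :=
          hFb.comp (measurable_mul_const v)
        rw [lintegral_mul_const _ hFbv, lintegral_mul_right_eq_self (fun u => F (block q u)) v]
    _ = _ := lintegral_const_mul _ hgm

theorem lintegral_matrix_append {n : ℕ} {F : Matrix (Fin (q + n)) (Fin q) ℂ → ENNReal}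
    (hF : Measurable F) :
    ∫⁻ Z, F Z = ∫⁻ A : Matrix (Fin q) (Fin q) ℂ, ∫⁻ C : Matrix (Fin n) (Fin q) ℂ,
      F (Fin.append A C) := by
  let e₁ := MeasurableEquiv.piCongrLeft (fun _ : Fin (q + n) => Fin q → ℂ) finSumFinEquiv
  let e₂ := (MeasurableEquiv.sumPiEquivProdPi fun _ : Fin q ⊕ Fin n => Fin q → ℂ).symm
  have h₁ : MeasurePreserving e₁ :=
    volume_measurePreserving_piCongrLeft (fun _ : Fin (q + n) => Fin q → ℂ) finSumFinEquiv
  have h₂ : MeasurePreserving e₂ :=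
    (volume_measurePreserving_sumPiEquivProdPi fun _ : Fin q ⊕ Fin n => Fin q → ℂ).symm _
  have h := h₁.comp h₂
  have happ (r : (Fin q → Fin q → ℂ) × (Fin n → Fin q → ℂ)) :
      (e₁ ∘ e₂) r = Fin.append r.1 r.2 := by
    have h1 : e₁ (e₂ r) ∘ finSumFinEquiv = Fin.append r.1 r.2 ∘ finSumFinEquiv := by
      ext1 i
      have : e₁ (e₂ r) (finSumFinEquiv i) = e₂ r i :=
        Equiv.piCongrLeft_apply_apply (fun _ : Fin (q + n) => Fin q → ℂ) finSumFinEquiv (e₂ r) i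
      rw [Function.comp_apply, this]
      rcases i with i | i
      · simp [e₂, MeasurableEquiv.sumPiEquivProdPi]
      · simp [e₂, MeasurableEquiv.sumPiEquivProdPi]
    exact finSumFinEquiv.surjective.injective_comp_right h1
  have key := h.lintegral_comp hF
  simp only [happ] at key
  have hm : Measurable fun r : (Fin q → Fin q → ℂ) × (Fin n → Fin q → ℂ) =>
      F (Fin.append r.1 r.2) := by
    simp only [← happ]
    exact hF.comp h.measurable
  rw [Measure.volume_eq_prod, lintegral_prod _ hm.aemeasurable] at key
  exact key.symm

/-- The two evaluations of the same integral over `M_{p,q}`, by normalization and by splitting into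
blocks, are compared here; the exponent is `n - q = p - 2q`. -/
theorem lintegral_block (h : 2 * q ≤ p) :
    ∫⁻ w : Matrix (Fin q) (Fin q) ℂ, ballWeight (p - 2 * q) w ≠ 0 ∧
    ∫⁻ w : Matrix (Fin q) (Fin q) ℂ, ballWeight (p - 2 * q) w ≠ ⊤ ∧
    ∀ F : Matrix (Fin q) (Fin q) ℂ → ENNReal, Measurable F →
      ∫⁻ u, F (block q u) ∂(unitaryHaar p) =
        (∫⁻ w : Matrix (Fin q) (Fin q) ℂ, ballWeight (p - 2 * q) w)⁻¹ *
          ∫⁻ w, ballWeight (p - 2 * q) w * F w := by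
  obtain ⟨n, rfl⟩ : ∃ n, p = q + n := ⟨p - q, by omega⟩
  have hqn : q ≤ n := by omega
  have hk : q + n - 2 * q = n - q := by omega
  rw [hk]
  -- The cutoff to bounded Gram matrices makes the total mass `V` finite and nonzero.
  let g : Matrix (Fin q) (Fin q) ℂ → ENNReal := (refSet q).indicator 1
  have hg : Measurable g := measurable_one.indicator (isOpen_refSet q).measurableSet
  let V := ∫⁻ Z : Matrix (Fin (q + n)) (Fin q) ℂ, g (Zᴴ * Z)
  have hVeq : V = volume {Z : Matrix (Fin (q + n)) (Fin q) ℂ | Zᴴ * Z ∈ refSet q} :=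
    lintegral_indicator_one (measurable_gram (isOpen_refSet q).measurableSet)
  have hV0 : V ≠ 0 := by
    rw [hVeq]
    refine (IsOpen.measure_pos _ ((isOpen_refSet q).preimage (by fun_prop)) ⟨0, ?_⟩).ne'
    intro i j
    simp
  have hVt : V ≠ ⊤ := by
    rw [hVeq]
    exact (volume_gram_refSet_lt_top _).ne
  obtain ⟨c, hc⟩ := exists_lintegral_block_eq hqn hg
  have key (F : Matrix (Fin q) (Fin q) ℂ → ENNReal) (hF : Measurable F) :
      (∫⁻ u, F (block q u) ∂(unitaryHaar (q + n))) * V =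
        c * ∫⁻ w, ballWeight (n - q) w * F w := by
    have hm : Measurable fun Z : Matrix (Fin (q + n)) (Fin q) ℂ =>
        F (normalizedBlock Z) * g (Zᴴ * Z) :=
      (hF.comp measurable_normalizedBlock).mul (hg.comp measurable_gram)
    rw [← hc F hF, ← lintegral_normalizedBlock (Nat.le_add_right q n) hF hg, lintegral_matrix_append hm]
    refine lintegral_congr fun A => lintegral_congr fun C => ?_
    have h1 : (embMat (q + n) q)ᴴ * Matrix.of (Fin.append A C) = A := by
      rw [conjTranspose_embMat_mul (Nat.le_add_right q n)]
      ext i j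
      exact congrFun (Fin.append_left A C i) j
    have h2 : (Matrix.of (Fin.append A C))ᴴ * Matrix.of (Fin.append A C) = Aᴴ * A + Cᴴ * C := by
      ext i j
      simp only [mul_apply, conjTranspose_apply, of_apply, Fin.sum_univ_add, Matrix.add_apply]
      congr 1
      · exact Finset.sum_congr rfl fun k _ => by
          rw [Fin.append_left A C k]
      · exact Finset.sum_congr rfl fun k _ => by
          rw [Fin.append_right A C k]
    change F (normalizedBlock (Matrix.of (Fin.append A C))) *
      g ((Matrix.of (Fin.append A C))ᴴ * Matrix.of (Fin.append A C)) = _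
    rw [normalizedBlock, h1, h2]
  -- The test function `1` gives `V = c * I`. Since `V` is neither `0` nor `⊤`, the same holds for
  -- `c` and `I`, and `c` can be cancelled.
  have hone := key 1 measurable_one
  simp only [Pi.one_apply, lintegral_const, measure_univ, mul_one, one_mul] at hone
  set I := ∫⁻ w : Matrix (Fin q) (Fin q) ℂ, ballWeight (n - q) w
  have hI0 : I ≠ 0 := fun h0 => hV0 (by rw [hone, h0, mul_zero])
  have hc0 : c ≠ 0 := fun h0 => hV0 (by rw [hone, h0, zero_mul])
  have hIt : I ≠ ⊤ := fun h0 => hVt (by rw [hone, h0, ENNReal.mul_top hc0])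
  refine ⟨hI0, hIt, fun F hF => ?_⟩
  have hF' := key F hF
  have hct : c ≠ ⊤ := fun h0 => hVt (by rw [hone, h0, ENNReal.top_mul hI0])
  rw [hone, mul_left_comm, ENNReal.mul_right_inj hc0 hct] at hF'
  rw [← hF', mul_left_comm, ENNReal.inv_mul_cancel hI0 hIt, mul_one]

end HaarBlock

/-! ### The topology of the group -/

section Group

variable {p q : ℕ}

theorem Heis.continuous_iff {X : Type*} [TopologicalSpace X] {f : X → Heis p q} :
    Continuous f ↔ Continuous (fun t => (f t).x) ∧ Continuous fun t => (f t).a :=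
  continuous_induced_rng.trans continuous_prodMk

theorem continuous_group_iff {X : Type*} [TopologicalSpace X] {f : X → G p q} :
    Continuous f ↔ (Continuous (fun t => (f t).left.x) ∧ Continuous fun t => (f t).left.a) ∧
      Continuous fun t => (f t).right :=
  continuous_induced_rng.trans (continuous_prodMk.trans (and_congr_left' Heis.continuous_iff))

theorem continuous_left_x : Continuous fun g : G p q => g.left.x :=
  (continuous_group_iff.mp continuous_id).1.1

theorem continuous_left_a : Continuous fun g : G p q => g.left.a :=
  (continuous_group_iff.mp continuous_id).1.2

theorem continuous_right : Continuous fun g : G p q => g.right :=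
  (continuous_group_iff.mp continuous_id).2

instance : SecondCountableTopology (U p) :=
  TopologicalSpace.Subtype.secondCountableTopology _

instance : SecondCountableTopology (Heis p q) :=
  TopologicalSpace.secondCountableTopology_induced _ _ _

instance : SecondCountableTopology (G p q) :=
  TopologicalSpace.secondCountableTopology_induced _ _ _

theorem action_apply_x (u : U p) (g : Heis p q) :
    (action p q u g).x = (u : Matrix (Fin p) (Fin p) ℂ) * g.x := rfl

theorem action_apply_a (u : U p) (g : Heis p q) : (action p q u g).a = g.a := rfl

theorem continuous_coe_right : Continuous fun g : G p q => (g.right : Matrix (Fin p) (Fin p) ℂ) :=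
  continuous_subtype_val.comp continuous_right

instance : ContinuousMul (G p q) where
  continuous_mul := by
    have x₁ := continuous_left_x.comp (continuous_fst : Continuous (Prod.fst : G p q × G p q → _))
    have x₂ := continuous_left_x.comp (continuous_snd : Continuous (Prod.snd : G p q × G p q → _))
    have a₁ := continuous_left_a.comp (continuous_fst : Continuous (Prod.fst : G p q × G p q → _))
    have a₂ := continuous_left_a.comp (continuous_snd : Continuous (Prod.snd : G p q × G p q → _))
    have u₁ := continuous_coe_right.comp
      (continuous_fst : Continuous (Prod.fst : G p q × G p q → _))
    have h := x₁.matrix_conjTranspose.matrix_mul (u₁.matrix_mul x₂)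
    refine continuous_group_iff.mpr ⟨⟨?_, ?_⟩, ?_⟩
    · exact x₁.add (u₁.matrix_mul x₂)
    · exact (a₁.add a₂).sub (Complex.continuous_im.comp h.matrix_trace)
    · exact (continuous_right.comp continuous_fst).mul (continuous_right.comp continuous_snd)

theorem continuous_inr : Continuous (SemidirectProduct.inr : U p → G p q) :=
  continuous_group_iff.mpr ⟨⟨continuous_const, continuous_const⟩, continuous_id⟩

theorem proj_inr_mul_mul_inr (k l : U p) (g : G p q) :
    proj p q (SemidirectProduct.inr k * g * SemidirectProduct.inr l) = proj p q g := by
  have hx : (SemidirectProduct.inr k * g * SemidirectProduct.inr l : G p q).left.x =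
      (k : Matrix (Fin p) (Fin p) ℂ) * g.left.x := by
    simp [action_apply_x]
  have ha : (SemidirectProduct.inr k * g * SemidirectProduct.inr l : G p q).left.a =
      g.left.a := by
    simp [action_apply_a]
  rw [proj, hx, ha, conjTranspose_unitary_mul_mul, proj]

theorem continuous_proj : Continuous (proj p q) := by
  refine Continuous.prodMk (Continuous.subtype_mk ?_ _) continuous_left_a
  refine (continuousOn_sqrt q).comp_continuous
    (continuous_left_x.matrix_conjTranspose.matrix_mul continuous_left_x) fun g => ?_
  exact nonneg_iff_posSemidef.mpr (posSemidef_conjTranspose_mul_self _)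

end Group

/-! ### Biinvariant measures on an orbit -/

section Orbit

variable {p q : ℕ}

/-- The element `k (h, 1) l` of `G_{p,q}`. -/
def orbitMap (h : Heis p q) (r : U p × U p) : G p q :=
  SemidirectProduct.inr r.1 * SemidirectProduct.inl h * SemidirectProduct.inr r.2

theorem continuous_orbitMap (h : Heis p q) : Continuous (orbitMap h) :=
  ((continuous_inr.comp continuous_fst).mul continuous_const).mul
    (continuous_inr.comp continuous_snd)

theorem measurable_orbitMap (h : Heis p q) : Measurable (orbitMap h) :=
  (continuous_orbitMap h).measurable

/-- The biinvariant probability measure on the double coset of `h`. -/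
def orbitMeasure (h : Heis p q) : Measure (G p q) :=
  ((unitaryHaar p).prod (unitaryHaar p)).map (orbitMap h)

instance (h : Heis p q) : IsProbabilityMeasure (orbitMeasure h) :=
  Measure.isProbabilityMeasure_map (measurable_orbitMap h).aemeasurable

theorem lintegral_orbitMeasure (h : Heis p q) {F : G p q → ENNReal} (hF : Measurable F) :
    ∫⁻ g, F g ∂(orbitMeasure h) =
      ∫⁻ k, ∫⁻ l, F (orbitMap h (k, l)) ∂(unitaryHaar p) ∂(unitaryHaar p) := by
  rw [orbitMeasure, lintegral_map hF (measurable_orbitMap h)]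
  exact lintegral_prod _ (hF.comp (measurable_orbitMap h)).aemeasurable

/-- Every point of a double coset serves equally well as base point: right invariance in `k` and
left invariance in `l` absorb `u` and `v`. -/
theorem lintegral_lintegral_orbitMap_mul (h : Heis p q) {F : G p q → ENNReal} (hF : Measurable F)
    (u v : U p) :
    ∫⁻ k, ∫⁻ l, F (orbitMap h (k * u, v * l)) ∂(unitaryHaar p) ∂(unitaryHaar p) =
      ∫⁻ g, F g ∂(orbitMeasure h) := by
  rw [lintegral_orbitMeasure h hF,
    ← lintegral_mul_right_eq_self (fun k => ∫⁻ l, F (orbitMap h (k, l)) ∂(unitaryHaar p)) u]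
  exact lintegral_congr fun k =>
    lintegral_mul_left_eq_self (fun l => F (orbitMap h (k * u, l))) v

theorem isBiinvariant_orbitMeasure (h : Heis p q) : IsBiinvariant (orbitMeasure h) where
  finite := inferInstance
  map_left u := by
    refine Measure.ext_of_lintegral _ fun F hF => ?_
    have hm : Measurable fun g : G p q => SemidirectProduct.inr u * g :=
      (continuous_const.mul continuous_id).measurable
    have hFm : Measurable fun g : G p q => F (SemidirectProduct.inr u * g) := hF.comp hm
    rw [lintegral_map hF hm, lintegral_orbitMeasure h hFm, lintegral_orbitMeasure h hF,
      ← lintegral_mul_left_eq_self (fun k => ∫⁻ l, F (orbitMap h (k, l)) ∂(unitaryHaar p)) u]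
    simp only [orbitMap, map_mul, mul_assoc]
  map_right u := by
    refine Measure.ext_of_lintegral _ fun F hF => ?_
    have hm : Measurable fun g : G p q => g * SemidirectProduct.inr u :=
      (continuous_id.mul continuous_const).measurable
    have hFm : Measurable fun g : G p q => F (g * SemidirectProduct.inr u) := hF.comp hm
    rw [lintegral_map hF hm, lintegral_orbitMeasure h hFm, lintegral_orbitMeasure h hF]
    refine lintegral_congr fun k => ?_
    rw [← lintegral_mul_right_eq_self (fun l => F (orbitMap h (k, l))) u]
    simp only [orbitMap, map_mul, mul_assoc]

theorem IsBiinvariant.lintegral_mul_mul {μ : Measure (G p q)} (hμ : IsBiinvariant μ)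
    {F : G p q → ENNReal} (hF : Measurable F) (k l : U p) :
    ∫⁻ g, F (SemidirectProduct.inr k * g * SemidirectProduct.inr l) ∂μ = ∫⁻ g, F g ∂μ := by
  have hl : Measurable fun g : G p q => SemidirectProduct.inr k * g :=
    (continuous_const.mul continuous_id).measurable
  have hr : Measurable fun g : G p q => g * SemidirectProduct.inr l :=
    (continuous_id.mul continuous_const).measurable
  have hFr : Measurable fun g : G p q => F (g * SemidirectProduct.inr l) := hF.comp hr
  rw [← lintegral_map (f := fun g => F (g * SemidirectProduct.inr l)) hFr hl, hμ.map_left,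
    ← lintegral_map hF hr, hμ.map_right]

theorem proj_orbitMap (h : Heis p q) (r : U p × U p) :
    proj p q (orbitMap h r) = proj p q (SemidirectProduct.inl h) :=
  proj_inr_mul_mul_inr _ _ _

theorem map_proj_orbitMeasure (h : Heis p q) :
    (orbitMeasure h).map (proj p q) = Measure.dirac (proj p q (SemidirectProduct.inl h)) := by
  rw [orbitMeasure, Measure.map_map continuous_proj.measurable (measurable_orbitMap h)]
  have : proj p q ∘ orbitMap h = fun _ => proj p q (SemidirectProduct.inl h) :=
    funext (proj_orbitMap h)
  rw [this, Measure.map_const, measure_univ, one_smul]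

/-- The representative `(r, 0; a)` of the orbit with invariants `(r, a)`. -/
def orbitRep (p : ℕ) (r : Cone q) (a : ℝ) : Heis p q := ⟨embMat p q * r.1, a⟩

theorem gram_orbitRep (h : q ≤ p) (r : Cone q) (a : ℝ) :
    (orbitRep p r a).xᴴ * (orbitRep p r a).x = r.1 * r.1 := by
  rw [orbitRep, conjTranspose_mul, Matrix.mul_assoc, ← Matrix.mul_assoc _ (embMat p q),
    conjTranspose_embMat_mul_embMat h, Matrix.one_mul, r.2.isHermitian.eq]

theorem proj_orbitRep (h : q ≤ p) (r : Cone q) (a : ℝ) :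
    proj p q (SemidirectProduct.inl (orbitRep p r a)) = (r, a) := by
  refine Prod.ext (Subtype.ext ?_) rfl
  change CFC.sqrt ((orbitRep p r a).xᴴ * (orbitRep p r a).x) = r.1
  rw [gram_orbitRep h]
  exact CFC.sqrt_mul_self r.1 (nonneg_iff_posSemidef.mpr r.2)

theorem exists_eq_orbitMap (h : q ≤ p) {g : G p q} {r : Cone q} {a : ℝ}
    (hg : proj p q g = (r, a)) : ∃ u v : U p, g = orbitMap (orbitRep p r a) (u, v) := by
  have h1 : CFC.sqrt (g.left.xᴴ * g.left.x) = r.1 := congrArg (fun z => (Prod.fst z).1) hg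
  have h2 : g.left.a = a := congrArg Prod.snd hg
  have h3 : (orbitRep p r a).xᴴ * (orbitRep p r a).x = g.left.xᴴ * g.left.x := by
    rw [gram_orbitRep h, ← h1, sqrt_mul_sqrt (posSemidef_conjTranspose_mul_self _)]
  obtain ⟨u, hu⟩ := exists_unitary_mul_eq h3
  -- `u` matches the matrix component; the second factor then corrects the unitary component.
  refine ⟨u, u⁻¹ * g.right, ?_⟩
  refine SemidirectProduct.ext (Heis.ext ?_ ?_) ?_
  · simp [orbitMap, action_apply_x, hu]
  · simp [orbitMap, action_apply_a, h2, orbitRep]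
  · simp [orbitMap]

/-- By biinvariance, integrating `F` against `μ` is the same as first averaging `F` over `k g l`.
Almost every `g` lies in the one double coset, where this average is the constant integral against
the orbit measure. -/
theorem IsBiinvariant.eq_orbitMeasure (h : q ≤ p) {μ : Measure (G p q)} (hμ : IsBiinvariant μ)
    {r : Cone q} {a : ℝ} (hmap : μ.map (proj p q) = Measure.dirac (r, a)) :
    μ = orbitMeasure (orbitRep p r a) := by
  have := hμ.finite
  have hmass : μ Set.univ = 1 := by
    rw [← Set.preimage_univ (f := proj p q), ← Measure.map_apply continuous_proj.measurable
      MeasurableSet.univ, hmap, measure_univ]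
  have hae : ∀ᵐ g ∂μ, proj p q g = (r, a) := by
    refine ae_of_ae_map (p := fun z => z = (r, a)) continuous_proj.measurable.aemeasurable ?_
    rw [hmap, ae_dirac_iff (measurableSet_eq)]
  refine Measure.ext_of_lintegral _ fun F hF => ?_
  have hm : Measurable fun t : (U p × U p) × G p q =>
      F (SemidirectProduct.inr t.1.1 * t.2 * SemidirectProduct.inr t.1.2) := by
    refine hF.comp (Continuous.measurable ?_)
    exact ((continuous_inr.comp (continuous_fst.comp continuous_fst)).mul continuous_snd).mul
      (continuous_inr.comp (continuous_snd.comp continuous_fst))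
  calc ∫⁻ g, F g ∂μ
      = ∫⁻ t : U p × U p, ∫⁻ g, F (SemidirectProduct.inr t.1 * g * SemidirectProduct.inr t.2) ∂μ
          ∂((unitaryHaar p).prod (unitaryHaar p)) := by
        simp only [hμ.lintegral_mul_mul hF, lintegral_const, measure_univ, mul_one]
    _ = ∫⁻ g, ∫⁻ t : U p × U p, F (SemidirectProduct.inr t.1 * g * SemidirectProduct.inr t.2)
          ∂((unitaryHaar p).prod (unitaryHaar p)) ∂μ :=
        lintegral_lintegral_swap hm.aemeasurable
    _ = ∫⁻ _, (∫⁻ g, F g ∂(orbitMeasure (orbitRep p r a))) ∂μ := by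
        refine lintegral_congr_ae ?_
        filter_upwards [hae] with g hg
        obtain ⟨u, v, rfl⟩ := exists_eq_orbitMap h hg
        have hm' : Measurable fun t : U p × U p => F (SemidirectProduct.inr t.1 *
            orbitMap (orbitRep p r a) (u, v) * SemidirectProduct.inr t.2) := by
          refine hF.comp (Continuous.measurable ?_)
          exact ((continuous_inr.comp continuous_fst).mul continuous_const).mul
            (continuous_inr.comp continuous_snd)
        rw [lintegral_prod _ hm'.aemeasurable, ← lintegral_lintegral_orbitMap_mul _ hF u v]
        simp only [orbitMap, map_mul, mul_assoc]
    _ = _ := by rw [lintegral_const, hmass, mul_one]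

theorem lift_dirac (h : q ≤ p) (r : Cone q) (a : ℝ) :
    lift p (Measure.dirac (r, a)) = orbitMeasure (orbitRep p r a) := by
  have hex : ∃! μ : Measure (G p q),
      IsBiinvariant μ ∧ μ.map (proj p q) = Measure.dirac (r, a) := by
    refine ⟨orbitMeasure (orbitRep p r a), ⟨isBiinvariant_orbitMeasure _, ?_⟩, fun μ hμ =>
      hμ.1.eq_orbitMeasure h hμ.2⟩
    rw [map_proj_orbitMeasure, proj_orbitRep h]
  rw [lift, dif_pos hex]
  exact hex.choose_spec.1.1.eq_orbitMeasure h hex.choose_spec.1.2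

end Orbit

/-! ### The convolution of point measures -/

section Convolution

variable {p q : ℕ}

/-- The product has matrix component `J r + u J s` with `J = embMat p q`. Its Gram matrix and the
Heisenberg cocycle involve `u` only through `(J r)ᴴ u J s = r w s`. -/
theorem proj_mul_eq_convPoint (h : q ≤ p) (r s : Cone q) (a b : ℝ) (u : U p) :
    proj p q (SemidirectProduct.inl (orbitRep p r a) * SemidirectProduct.inr u *
      SemidirectProduct.inl (orbitRep p s b)) = convPoint r s a b (block q u) := by
  set g : G p q := SemidirectProduct.inl (orbitRep p r a) * SemidirectProduct.inr u *
    SemidirectProduct.inl (orbitRep p s b)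
  have hx : g.left.x = embMat p q * r.1 + (u : Matrix (Fin p) (Fin p) ℂ) * (embMat p q * s.1) := by
    simp [g, action_apply_x, orbitRep]
  have hcross : (embMat p q * r.1)ᴴ * ((u : Matrix (Fin p) (Fin p) ℂ) * (embMat p q * s.1)) =
      r.1 * Matrix.of (block q u) * s.1 := by
    change _ = r.1 * block q u * s.1
    rw [conjTranspose_mul, r.2.isHermitian.eq, block]
    simp only [Matrix.mul_assoc]
  have ha : g.left.a = a + b - (trace (r.1 * Matrix.of (block q u) * s.1)).im := by
    rw [← hcross]
    simp [g, action_apply_a, action_apply_x, orbitRep]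
  have hr := gram_orbitRep h r a
  have hs := gram_orbitRep h s b
  have hgram : g.left.xᴴ * g.left.x = r.1 ^ 2 + s.1 ^ 2 + r.1 * Matrix.of (block q u) * s.1 +
      (r.1 * Matrix.of (block q u) * s.1)ᴴ := by
    have h1 : (embMat p q * r.1)ᴴ * (embMat p q * r.1) = r.1 * r.1 := hr
    have h2 : (embMat p q * s.1)ᴴ * (embMat p q * s.1) = s.1 * s.1 := hs
    have h3 : ((u : Matrix (Fin p) (Fin p) ℂ) * (embMat p q * s.1))ᴴ * (embMat p q * r.1) =
        (r.1 * Matrix.of (block q u) * s.1)ᴴ := by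
      rw [← hcross, conjTranspose_mul (embMat p q * r.1)ᴴ, conjTranspose_conjTranspose]
    rw [hx, conjTranspose_add, Matrix.add_mul, Matrix.mul_add, Matrix.mul_add,
      conjTranspose_unitary_mul_mul, h1, h2, hcross, h3, sq, sq]
    abel
  rw [proj, hgram, ha]
  rfl

/-- Of the four Haar variables, the outermost two do not affect `proj`, and the inner two enter only
through their product. -/
theorem lintegral_orbitConv (h : q ≤ p) (r s : Cone q) (a b : ℝ) {F : Cone q × ℝ → ENNReal}
    (hF : Measurable F) :
    ∫⁻ z, F z ∂(orbitConv p (Measure.dirac (r, a)) (Measure.dirac (s, b))) =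
      ∫⁻ u, F (convPoint r s a b (block q u)) ∂(unitaryHaar p) := by
  have hFp : Measurable fun g : G p q => F (proj p q g) := hF.comp continuous_proj.measurable
  have hFpm : Measurable fun t : G p q × G p q => F (proj p q (t.1 * t.2)) :=
    hFp.comp continuous_mul.measurable
  rw [orbitConv, lift_dirac h, lift_dirac h, lintegral_map hF continuous_proj.measurable,
    Measure.mconv, lintegral_map hFp continuous_mul.measurable,
    lintegral_prod _ hFpm.aemeasurable]
  have hinner (g : G p q) : ∫⁻ g', F (proj p q (g * g')) ∂(orbitMeasure (orbitRep p s b)) =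
      ∫⁻ k, F (proj p q (g * (SemidirectProduct.inr k *
        SemidirectProduct.inl (orbitRep p s b)))) ∂(unitaryHaar p) := by
    have hm : Measurable fun g' => F (proj p q (g * g')) := by
      have := hFpm.comp (measurable_prodMk_left (x := g))
      exact this
    rw [lintegral_orbitMeasure _ hm]
    refine lintegral_congr fun k => ?_
    have hl (l : U p) : proj p q (g * orbitMap (orbitRep p s b) (k, l)) =
        proj p q (g * (SemidirectProduct.inr k * SemidirectProduct.inl (orbitRep p s b))) := by
      have := proj_inr_mul_mul_inr 1 l
        (g * (SemidirectProduct.inr k * SemidirectProduct.inl (orbitRep p s b)))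
      rw [map_one, one_mul] at this
      rw [← this, orbitMap]
      simp only [mul_assoc]
    simp only [hl, lintegral_const, measure_univ, mul_one]
  simp only [hinner]
  have hm : Measurable fun t : G p q × U p => F (proj p q (t.1 * (SemidirectProduct.inr t.2 *
      SemidirectProduct.inl (orbitRep p s b)))) := by
    refine hFp.comp (Continuous.measurable ?_)
    exact continuous_fst.mul ((continuous_inr.comp continuous_snd).mul continuous_const)
  rw [lintegral_orbitMeasure _ (hm.lintegral_prod_right' (ν := unitaryHaar p) :)]
  have hconst (k l : U p) :
      ∫⁻ k', F (proj p q (orbitMap (orbitRep p r a) (k, l) * (SemidirectProduct.inr k' *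
        SemidirectProduct.inl (orbitRep p s b)))) ∂(unitaryHaar p) =
      ∫⁻ u, F (convPoint r s a b (block q u)) ∂(unitaryHaar p) := by
    -- Left invariance turns the product `l * k'` into a single Haar variable.
    rw [← lintegral_mul_left_eq_self (fun u => F (convPoint r s a b (block q u))) l]
    refine lintegral_congr fun k' => ?_
    congr 1
    rw [← proj_mul_eq_convPoint h]
    have := proj_inr_mul_mul_inr k 1 (SemidirectProduct.inl (orbitRep p r a) *
      SemidirectProduct.inr (l * k') * SemidirectProduct.inl (orbitRep p s b))
    rw [← this, orbitMap]
    simp only [map_mul, map_one, mul_one, mul_assoc]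
  simp only [hconst, lintegral_const, measure_univ, mul_one]

theorem measurable_convPoint (r s : Cone q) (a b : ℝ) : Measurable (convPoint r s a b) := by
  have hc : Continuous fun w : Entries q => r.1 * Matrix.of w * s.1 := by
    change Continuous fun w : Matrix (Fin q) (Fin q) ℂ => r.1 * w * s.1
    fun_prop
  refine Measurable.prodMk ?_ ?_
  · have hm : Measurable fun w : Entries q => CFC.sqrt (r.1 ^ 2 + s.1 ^ 2 +
        r.1 * Matrix.of w * s.1 + (r.1 * Matrix.of w * s.1)ᴴ) :=
      measurable_sqrt.comp ((continuous_const.add hc).add hc.matrix_conjTranspose).measurable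
    refine measurable_of_isOpen fun V hV => ?_
    obtain ⟨W, hW, rfl⟩ := isOpen_induced_iff.mp hV
    exact hm hW.measurableSet
  · exact (continuous_const.sub (Complex.continuous_im.comp hc.matrix_trace)).measurable

end Convolution

/-! ### The matrix ball and its real-valued density. -/

section Ball

variable {q : ℕ}

theorem continuous_one_sub_gram :
    Continuous fun w : Entries q => 1 - (Matrix.of w)ᴴ * Matrix.of w := by
  change Continuous fun w : Matrix (Fin q) (Fin q) ℂ => 1 - wᴴ * w
  fun_prop

theorem measurableSet_matrixBall (q : ℕ) : MeasurableSet (matrixBall q) :=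
  continuous_one_sub_gram.measurable (measurableSet_posDefSet q)

theorem continuous_ballDet : Continuous (ballDet (q := q)) :=
  Complex.continuous_re.comp continuous_one_sub_gram.matrix_det

theorem ballDet_pos {w : Entries q} (hw : w ∈ matrixBall q) : 0 < ballDet w :=
  (Complex.pos_iff.mp (PosDef.det_pos hw)).1

theorem ballWeight_eq_indicator (k : ℕ) (w : Entries q) :
    ballWeight k (Matrix.of w) =
      (matrixBall q).indicator (fun w => ENNReal.ofReal (ballDet w ^ k)) w := by
  by_cases hw : w ∈ matrixBall q
  · have hdet := Complex.pos_iff.mp (PosDef.det_pos hw)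
    have h : ‖(1 - (Matrix.of w)ᴴ * Matrix.of w).det‖ₑ = ENNReal.ofReal (ballDet w) := by
      rw [← ofReal_norm, Complex.norm_eq_sqrt_sq_add_sq, ← hdet.2, zero_pow two_ne_zero, add_zero,
        Real.sqrt_sq hdet.1.le, ballDet]
    rw [Set.indicator_of_mem hw, ballWeight, pdInd_of_posDef hw, one_mul, h,
      ENNReal.ofReal_pow (ballDet_pos hw).le]
  · rw [Set.indicator_of_notMem hw, ballWeight, pdInd_of_not_posDef hw, zero_mul]

theorem lintegral_ballWeight_mul (k : ℕ) (F : Entries q → ENNReal) :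
    ∫⁻ w : Matrix (Fin q) (Fin q) ℂ, ballWeight k w * F w =
      ∫⁻ w in matrixBall q, ENNReal.ofReal (ballDet w ^ k) * F w := by
  rw [← lintegral_indicator (measurableSet_matrixBall q)]
  refine lintegral_congr (μ := (volume : Measure (Entries q))) fun w => ?_
  rw [Set.indicator_mul_left]
  exact congrArg (· * F w) (ballWeight_eq_indicator k w)

end Ball

/-! ### The normalizing constant and the integral formula. -/

section Law

variable {p q : ℕ}

theorem lintegral_ball_eq :
    ∫⁻ w in matrixBall q, ENNReal.ofReal (ballDet w ^ (p - 2 * q)) =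
      ∫⁻ w : Matrix (Fin q) (Fin q) ℂ, ballWeight (p - 2 * q) w := by
  simpa using (lintegral_ballWeight_mul (p - 2 * q) (q := q) fun _ => 1).symm

theorem measurable_ballDet_pow (k : ℕ) : Measurable fun w : Entries q => ballDet w ^ k :=
  (continuous_ballDet.pow k).measurable

theorem ae_ballDet_pow_nonneg (k : ℕ) :
    0 ≤ᵐ[volume.restrict (matrixBall q)] fun w : Entries q => ballDet w ^ k := by
  filter_upwards [ae_restrict_mem (measurableSet_matrixBall q)] with w hw
  exact pow_nonneg (ballDet_pos hw).le _

theorem integrableOn_ballDet_pow (h : 2 * q ≤ p) :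
    IntegrableOn (fun w : Entries q => ballDet w ^ (p - 2 * q)) (matrixBall q) := by
  refine ⟨(measurable_ballDet_pow _).aestronglyMeasurable, ?_⟩
  rw [hasFiniteIntegral_iff_ofReal (ae_ballDet_pow_nonneg _), lintegral_ball_eq]
  exact (lintegral_block h).2.1.lt_top

theorem kappa_eq (h : 2 * q ≤ p) :
    ENNReal.ofReal (kappa p q) =
      (∫⁻ w : Matrix (Fin q) (Fin q) ℂ, ballWeight (p - 2 * q) w)⁻¹ ∧ 0 < kappa p q := by
  have hint : ENNReal.ofReal (∫ w in matrixBall q, ballDet w ^ (p - 2 * q)) =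
      ∫⁻ w : Matrix (Fin q) (Fin q) ℂ, ballWeight (p - 2 * q) w := by
    rw [ofReal_integral_eq_lintegral_ofReal (integrableOn_ballDet_pow h) (ae_ballDet_pow_nonneg _),
      lintegral_ball_eq]
  have hpos : 0 < ∫ w in matrixBall q, ballDet w ^ (p - 2 * q) := by
    rw [← ENNReal.ofReal_pos, hint]
    exact pos_iff_ne_zero.mpr (lintegral_block h).1
  exact ⟨by rw [kappa, ENNReal.ofReal_inv_of_pos hpos, hint], inv_pos.mpr hpos⟩

/-- As an identity of measures, this transfers the `ENNReal` computation to Bochner integrals of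
complex functions. -/
theorem orbitConv_eq_map (h : 2 * q ≤ p) (r s : Cone q) (a b : ℝ) :
    orbitConv p (Measure.dirac (r, a)) (Measure.dirac (s, b)) =
      (ENNReal.ofReal (kappa p q) • ((volume.restrict (matrixBall q)).withDensity fun w =>
        ENNReal.ofReal (ballDet w ^ (p - 2 * q)))).map (convPoint r s a b) := by
  refine Measure.ext_of_lintegral _ fun F hF => ?_
  have hFc : Measurable fun w : Entries q => F (convPoint r s a b w) :=
    hF.comp (measurable_convPoint r s a b)
  rw [lintegral_orbitConv (by omega) r s a b hF,
    (lintegral_block h).2.2 (fun w => F (convPoint r s a b w)) hFc,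
    lintegral_map hF (measurable_convPoint r s a b), lintegral_smul_measure,
    lintegral_withDensity_eq_lintegral_mul _ (measurable_ballDet_pow _).ennreal_ofReal hFc,
    (kappa_eq h).1, smul_eq_mul, lintegral_ballWeight_mul _ fun w => F (convPoint r s a b w)]
  rfl

theorem isProbabilityMeasure_orbitConv (h : q ≤ p) (r s : Cone q) (a b : ℝ) :
    IsProbabilityMeasure (orbitConv p (Measure.dirac (r, a)) (Measure.dirac (s, b))) := by
  refine ⟨?_⟩
  rw [← lintegral_one, lintegral_orbitConv h r s a b measurable_const, lintegral_const,
    measure_univ, one_mul]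

theorem integrableOn_convPoint (h : 2 * q ≤ p) (r s : Cone q) (a b : ℝ)
    (f : (Cone q × ℝ) →ᵇ ℂ) :
    IntegrableOn (fun w : Entries q =>
      f (convPoint r s a b w) * ((ballDet w ^ (p - 2 * q) : ℝ) : ℂ)) (matrixBall q) := by
  refine Integrable.bdd_mul (c := ‖f‖) (integrableOn_ballDet_pow h).ofReal ?_ ?_
  · exact (f.continuous.measurable.comp (measurable_convPoint r s a b)).aestronglyMeasurable
  · exact Filter.Eventually.of_forall fun w => f.norm_coe_le_norm _

theorem integral_orbitConv (h : 2 * q ≤ p) (r s : Cone q) (a b : ℝ) (f : (Cone q × ℝ) →ᵇ ℂ) :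
    ∫ z, f z ∂(orbitConv p (Measure.dirac (r, a)) (Measure.dirac (s, b))) =
      (kappa p q : ℂ) * ∫ w in matrixBall q,
        f (convPoint r s a b w) * ((ballDet w ^ (p - 2 * q) : ℝ) : ℂ) := by
  rw [orbitConv_eq_map h, integral_map (measurable_convPoint r s a b).aemeasurable
    f.continuous.measurable.aestronglyMeasurable, integral_smul_measure,
    ENNReal.toReal_ofReal (kappa_eq h).2.le,
    integral_withDensity_eq_integral_toReal_smul (measurable_ballDet_pow _).ennreal_ofReal
      (Filter.Eventually.of_forall fun _ => ENNReal.ofReal_lt_top), Complex.real_smul]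
  congr 1
  refine setIntegral_congr_fun (measurableSet_matrixBall q) fun w hw => ?_
  rw [ENNReal.toReal_ofReal (pow_nonneg (ballDet_pos hw).le _), Complex.real_smul, mul_comm]

end Law

end HeisenbergConvolution

end

open HeisenbergConvolution in
theorem mainTheorem7 (p q : ℕ) (hq : 1 ≤ q) (hpq : 2 * q ≤ p) :
    IntegrableOn (fun w : Entries q => ballDet w ^ (p - 2 * q)) (matrixBall q) ∧
    0 < kappa p q ∧
    ∀ (r s : Cone q) (a b : ℝ),
      IsProbabilityMeasure (orbitConv p (Measure.dirac (r, a)) (Measure.dirac (s, b))) ∧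
      ∀ f : (Cone q × ℝ) →ᵇ ℂ,
        IntegrableOn (fun w : Entries q =>
          f (convPoint r s a b w) * ((ballDet w ^ (p - 2 * q) : ℝ) : ℂ)) (matrixBall q) ∧
        ∫ z, f z ∂(orbitConv p (Measure.dirac (r, a)) (Measure.dirac (s, b))) =
          (kappa p q : ℂ) * ∫ w in matrixBall q,
            f (convPoint r s a b w) * ((ballDet w ^ (p - 2 * q) : ℝ) : ℂ) :=
  ⟨integrableOn_ballDet_pow hpq, (kappa_eq hpq).2, fun r s a b =>
    ⟨isProbabilityMeasure_orbitConv (by omega) r s a b, fun f =>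
      ⟨integrableOn_convPoint hpq r s a b f, integral_orbitConv hpq r s a b f⟩⟩⟩
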